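/- Let $V$ be a non-empty finite or countably infinite set and $m:V\to(0,\infty)$, regarded as a measure on $V$. Let $(b,c)$ be a weighted graph over $V$: $c:V\to[0,\infty)$ and $b:V\times V\to[0,\infty)$ with $b(x,x)=0$, $b(x,y)=b(y,x)$ and $\sum_{y}b(x,y)<\infty$ for all $x,y\in V$. Assume that the graph is connected, i.e. any two distinct points of $V$ are joined by a finite path $x_0,\dots,x_n$ with $b(x_i,x_{i+1})>0$ for all $i$. On $\widetilde F=\{u:V\to\mathbb C:\sum_y|b(x,y)u(y)|<\infty\text{ for all }x\in V\}$ let $$\widetilde L u(x)=\frac1{m(x)}\sum_{y}b(x,y)\,(u(x)-u(y))+\frac{c(x)}{m(x)}u(x).$$ Let $L$ be a non-negative self-adjoint operator in the complex Hilbert space $\ell^2(V,m)$ which is a restriction of $\widetilde L$ (i.e. $D(L)\subseteq\widetilde F$ and $Lu=\widetilde Lu$ for $u\in D(L)$), and such that for every $t>0$ the operator $e^{-tL}$ maps non-negative functions to non-negative functions. Let $p_t(x,y)$ be the kernel of $e^{-tL}$, so that $e^{-tL}f(x)=\sum_{y}p_t(x,y)f(y)m(y)$ for all $f\in\ell^2(V,m)$,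 $x\in V$, and let $E_0$ be the infimum of the spectrum of $L$ (which is non-empty and bounded below). Then: (a) There is a unique function $\Phi:V\to[0,\infty)$ such that $$e^{tE_0}p_t(x,y)\to\Phi(x)\Phi(y)\qquad(t\to\infty)\quad\text{for all }x,y\in V.$$ If $E_0$ is not an eigenvalue of $L$, then $\Phi\equiv0$. If $E_0$ is an eigenvalue of $L$, then $\Phi$ is strictly positive and is an eigenfunction of $L$ to $E_0$ with $\|\Phi\|_{\ell^2(V,m)}=1$, and it is the only non-negative eigenfunction of $L$ to $E_0$ of norm one. (b) For all $x,y\in V$ one has $p_t(x,y)>0$ for all $t>0$, and $$\frac{\log p_t(x,y)}{t}\to-E_0\qquad(t\to\infty).$$ -/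

import Mathlib

open MeasureTheory Filter Topology

noncomputable section

/-! ## Graphs over discrete measure spaces and the formal Laplacian -/

/-- A symmetric weighted graph `(b, c)` over the vertex set `V`. -/
structure WeightedGraph (V : Type*) where
  b : V → V → ℝ
  c : V → ℝ
  b_nonneg : ∀ x y, 0 ≤ b x y
  c_nonneg : ∀ x, 0 ≤ c x
  b_diag : ∀ x, b x x = 0
  b_symm : ∀ x y, b x y = b y x
  b_summable : ∀ x, Summable (b x)

namespace WeightedGraph

/-- Any two vertices are joined by a finite path of edges of positive weight. -/
def IsConnected {V : Type*} (G : WeightedGraph V) : Prop :=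
  ∀ x y : V, Relation.ReflTransGen (fun u v => 0 < G.b u v) x y

/-- The domain `F̃` of the formal Laplacian. -/
def formalDomain {V : Type*} (G : WeightedGraph V) : Set (V → ℂ) :=
  {u | ∀ x, Summable fun y => ‖(G.b x y : ℂ) * u y‖}

/-- The standard formal Laplacian `L̃` of the graph over `(V, m)`. -/
def formalLaplacian {V : Type*} (G : WeightedGraph V) (m : V → ℝ) (u : V → ℂ) (x : V) : ℂ :=
  (1 / (m x : ℂ)) * (∑' y, (G.b x y : ℂ) * (u x - u y)) + ((G.c x : ℂ) / (m x : ℂ)) * u x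

end WeightedGraph

/-- The measure on `V` that gives the point `x` the mass `m x`. -/
def discreteMeasure {V : Type*} [MeasurableSpace V] (m : V → ℝ) : Measure V :=
  Measure.sum fun x => ENNReal.ofReal (m x) • Measure.dirac x

/-- The Hilbert space `ℓ²(V, m)` of complex-valued square summable functions. -/
abbrev WeightedL2 {V : Type*} [MeasurableSpace V] (m : V → ℝ) : Type _ :=
  Lp ℂ 2 (discreteMeasure m)

theorem discreteMeasure_singleton {V : Type*} [MeasurableSpace V] [DiscreteMeasurableSpace V]
    (m : V → ℝ) (x : V) : discreteMeasure m {x} = ENNReal.ofReal (m x) := by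
  classical
  rw [discreteMeasure, Measure.sum_apply _ (MeasurableSet.of_discrete), tsum_eq_single x]
  · simp
  · intro y hy
    simp [hy]

theorem discreteMeasure_singleton_ne_top {V : Type*} [MeasurableSpace V]
    [DiscreteMeasurableSpace V] (m : V → ℝ) (x : V) : discreteMeasure m {x} ≠ ⊤ := by
  rw [discreteMeasure_singleton]
  exact ENNReal.ofReal_ne_top

/-- The characteristic function `δ_x` of the point `x`, as an element of `ℓ²(V, m)`. -/
def pointFunction {V : Type*} [MeasurableSpace V] [DiscreteMeasurableSpace V]
    (m : V → ℝ) (x : V) : WeightedL2 m :=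
  indicatorConstLp 2 (MeasurableSet.of_discrete (s := {x}))
    (discreteMeasure_singleton_ne_top m x) (1 : ℂ)

/-! ## Unbounded operators: spectrum, eigenvalues, resolvent and heat semigroup -/

namespace UnboundedOp

/-- `R` is a bounded, everywhere defined two-sided inverse of `L - z`. -/
def IsResolventAt {H : Type*} [NormedAddCommGroup H] [InnerProductSpace ℂ H]
    (L : H →ₗ.[ℂ] H) (z : ℂ) (R : H →L[ℂ] H) : Prop :=
  (∀ f : H, ∃ h : R f ∈ L.domain, L ⟨R f, h⟩ - z • R f = f) ∧
    ∀ u : L.domain, R (L u - z • (u : H)) = u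

/-- The spectrum of an unbounded operator: the `z` for which `L - z` has no bounded inverse. -/
def spectrum {H : Type*} [NormedAddCommGroup H] [InnerProductSpace ℂ H]
    (L : H →ₗ.[ℂ] H) : Set ℂ :=
  {z | ¬ ∃ R : H →L[ℂ] H, IsResolventAt L z R}

/-- The real points of the spectrum (for a self-adjoint operator, this is the whole spectrum). -/
def realSpectrum {H : Type*} [NormedAddCommGroup H] [InnerProductSpace ℂ H]
    (L : H →ₗ.[ℂ] H) : Set ℝ :=
  {s | (s : ℂ) ∈ spectrum L}

/-- The infimum `E₀` of the spectrum of a self-adjoint operator. -/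
def bottom {H : Type*} [NormedAddCommGroup H] [InnerProductSpace ℂ H]
    (L : H →ₗ.[ℂ] H) : ℝ :=
  sInf (realSpectrum L)

/-- `E` is an eigenvalue of `L`. -/
def IsEigenvalue {H : Type*} [NormedAddCommGroup H] [InnerProductSpace ℂ H]
    (L : H →ₗ.[ℂ] H) (E : ℝ) : Prop :=
  ∃ u : L.domain, (u : H) ≠ 0 ∧ L u = (E : ℂ) • (u : H)

/-- `⟨u, L u⟩ ≥ 0` on the domain of `L`. -/
def IsNonnegative {H : Type*} [NormedAddCommGroup H] [InnerProductSpace ℂ H]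
    (L : H →ₗ.[ℂ] H) : Prop :=
  ∀ u : L.domain, 0 ≤ (inner ℂ (u : H) (L u)).re ∧ (inner ℂ (u : H) (L u)).im = 0

open scoped Classical in
/-- The resolvent `(L - z)⁻¹` (with the value `0` if `z` is in the spectrum). -/
def resolvent {H : Type*} [NormedAddCommGroup H] [InnerProductSpace ℂ H]
    (L : H →ₗ.[ℂ] H) (z : ℂ) : H →L[ℂ] H :=
  if h : ∃ R : H →L[ℂ] H, IsResolventAt L z R then h.choose else 0

theorem IsResolventAt.unique {H : Type*} [NormedAddCommGroup H] [InnerProductSpace ℂ H]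
    {L : H →ₗ.[ℂ] H} {z : ℂ} {R S : H →L[ℂ] H}
    (hR : IsResolventAt L z R) (hS : IsResolventAt L z S) : R = S := by
  ext f
  obtain ⟨h, hf⟩ := hR.1 f
  have := hS.2 ⟨R f, h⟩
  rw [hf] at this
  exact this.symm

/-- A non-negative self-adjoint operator has a resolvent at `-1`. -/
theorem exists_isResolventAt_neg_one {H : Type*} [NormedAddCommGroup H] [InnerProductSpace ℂ H]
    [CompleteSpace H] {L : H →ₗ.[ℂ] H} (hsa : IsSelfAdjoint L) (hpos : IsNonnegative L) :
    ∃ R : H →L[ℂ] H, IsResolventAt L (-1) R := by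
  have hd : Dense (L.domain : Set H) := hsa.dense_domain
  have hadj : L.adjoint = L := LinearPMap.isSelfAdjoint_def.mp hsa
  set A : L.domain →ₗ[ℂ] H := L.toFun + L.domain.subtype with hA
  have hAu : ∀ u : L.domain, A u = L u + (u : H) := fun u => rfl
  have hbd : ∀ u : L.domain, ‖(u : H)‖ ≤ ‖A u‖ := by
    intro u
    have h1 : ‖(u : H)‖ * ‖(u : H)‖ ≤ ‖(u : H)‖ * ‖A u‖ := by
      calc ‖(u : H)‖ * ‖(u : H)‖ = (inner ℂ (u : H) (u : H)).re := by
            rw [← @inner_self_eq_norm_mul_norm ℂ]; rfl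
        _ ≤ (inner ℂ (u : H) (A u)).re := by
            rw [hAu, inner_add_right, Complex.add_re]
            linarith [(hpos u).1]
        _ ≤ ‖inner ℂ (u : H) (A u)‖ := Complex.re_le_norm _
        _ ≤ _ := norm_inner_le_norm _ _
    by_cases h0 : ‖(u : H)‖ = 0
    · rw [h0]; exact norm_nonneg _
    · exact le_of_mul_le_mul_left h1 (lt_of_le_of_ne (norm_nonneg _) (Ne.symm h0))
  have hinj : Function.Injective A := by
    rw [injective_iff_map_eq_zero]
    intro u hu
    have := hbd u
    rw [hu, norm_zero] at this
    exact Subtype.ext (norm_le_zero_iff.mp this)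
  have hclosed : IsClosed (LinearMap.range A : Set H) := by
    rw [← isSeqClosed_iff_isClosed]
    intro f g hf hfg
    choose u hu using hf
    have hcu : CauchySeq fun n => (u n : H) := by
      have hcf := hfg.cauchySeq
      rw [Metric.cauchySeq_iff] at hcf ⊢
      intro ε hε
      obtain ⟨N, hN⟩ := hcf ε hε
      refine ⟨N, fun i hi j hj => lt_of_le_of_lt ?_ (hN i hi j hj)⟩
      rw [dist_eq_norm, dist_eq_norm, ← hu i, ← hu j, ← map_sub]
      exact hbd (u i - u j)
    obtain ⟨w, hw⟩ := cauchySeq_tendsto_of_complete hcu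
    have hlim : Tendsto (fun n => L (u n)) atTop (𝓝 (g - w)) := by
      have h2 := hfg.sub hw
      refine h2.congr fun n => ?_
      rw [← hu n, hAu, add_sub_cancel_right]
    have hform : ∀ v : L.domain, inner ℂ (g - w) (v : H) = inner ℂ w (L v) := by
      intro v
      have h3 : Tendsto (fun n => inner ℂ (L (u n)) (v : H)) atTop (𝓝 (inner ℂ (g - w) (v : H))) :=
        hlim.inner tendsto_const_nhds
      have h4 : Tendsto (fun n => inner ℂ (u n : H) (L v)) atTop (𝓝 (inner ℂ w (L v))) :=
        hw.inner tendsto_const_nhds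
      refine tendsto_nhds_unique h3 (h4.congr fun n => ?_)
      have h5 := LinearPMap.adjoint_isFormalAdjoint hd
      rw [hadj] at h5
      exact (h5 (u n) v).symm
    have hwd : w ∈ L.adjoint.domain :=
      LinearPMap.mem_adjoint_domain_of_exists w ⟨g - w, hform⟩
    have hval : L.adjoint ⟨w, hwd⟩ = g - w := LinearPMap.adjoint_apply_eq hd _ hform
    rw [LinearMap.coe_range]
    have key : ∀ T : H →ₗ.[ℂ] H, T = L → ∀ hT : w ∈ T.domain, T ⟨w, hT⟩ = g - w →
        ∃ v : L.domain, A v = g := by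
      rintro T rfl hT hv
      exact ⟨⟨w, hT⟩, by rw [hAu, hv]; simp⟩
    exact key _ hadj hwd hval
  have hrange : LinearMap.range A = ⊤ := by
    have : CompleteSpace (LinearMap.range A) := hclosed.completeSpace_coe
    rw [← Submodule.orthogonal_eq_bot_iff, Submodule.eq_bot_iff]
    intro v hv
    have hv' : ∀ u : L.domain, inner ℂ (-v) (u : H) = inner ℂ v (L u) := by
      intro u
      have h1 : inner ℂ v (A u) = 0 :=
        (Submodule.mem_orthogonal' _ _).mp hv _ (LinearMap.mem_range_self A u)
      rw [hAu, inner_add_right] at h1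
      rw [inner_neg_left]
      linear_combination -h1
    have hvd : v ∈ L.adjoint.domain :=
      LinearPMap.mem_adjoint_domain_of_exists v ⟨-v, hv'⟩
    have hval : L.adjoint ⟨v, hvd⟩ = -v := LinearPMap.adjoint_apply_eq hd _ hv'
    have key : ∀ T : H →ₗ.[ℂ] H, T = L → ∀ hT : v ∈ T.domain, T ⟨v, hT⟩ = -v → v = 0 := by
      rintro T rfl hT hTv
      have := hbd ⟨v, hT⟩
      rw [hAu, hTv] at this
      simpa using this
    exact key _ hadj hvd hval
  let e : L.domain ≃ₗ[ℂ] H :=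
    LinearEquiv.ofBijective A ⟨hinj, LinearMap.range_eq_top.mp hrange⟩
  have he : ∀ u, e u = A u := fun u => rfl
  refine ⟨LinearMap.mkContinuous (L.domain.subtype ∘ₗ e.symm.toLinearMap) 1 ?_, ?_, ?_⟩
  · intro f
    have := hbd (e.symm f)
    rw [← he, e.apply_symm_apply] at this
    simpa using this
  · intro f
    refine ⟨(e.symm f).2, ?_⟩
    have h1 : A (e.symm f) = f := by rw [← he, e.apply_symm_apply]
    rw [hAu] at h1
    simpa using h1
  · intro u
    have h1 : e.symm (A u) = u := by rw [← he, e.symm_apply_apply]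
    have h2 : L u - (-1 : ℂ) • (u : H) = A u := by rw [hAu]; simp
    rw [h2]
    simp [h1]

theorem resolvent_spec {H : Type*} [NormedAddCommGroup H] [InnerProductSpace ℂ H]
    [CompleteSpace H] {L : H →ₗ.[ℂ] H} (hsa : IsSelfAdjoint L) (hpos : IsNonnegative L) :
    IsResolventAt L (-1) (resolvent L (-1)) := by
  have h := exists_isResolventAt_neg_one hsa hpos
  rw [resolvent, dif_pos h]
  exact h.choose_spec

/-- The function `r ↦ exp(-t (r⁻¹ - 1))` on `(0, ∞)`, extended by `0`. Under the substitution
`r = (s + 1)⁻¹` it becomes the function `s ↦ exp(-t s)` of `s ∈ [0, ∞)`. -/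
def heatSymbol (t r : ℝ) : ℝ :=
  if r ≤ 0 then 0 else Real.exp (-t * (r⁻¹ - 1))

/-- The semigroup `e^{-tL}` of a non-negative self-adjoint operator `L`, for `t ≥ 0`, through the
functional calculus: for `t > 0` the function `s ↦ exp(-t s)` of `L` is the continuous function
`heatSymbol t` of the bounded self-adjoint operator `(L + 1)⁻¹`, whose spectrum is contained
in `[0, 1]`. -/
def heatSemigroup {H : Type*} [NormedAddCommGroup H] [InnerProductSpace ℂ H] [CompleteSpace H]
    (L : H →ₗ.[ℂ] H) (t : ℝ) : H →L[ℂ] H :=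
  if t = 0 then 1 else cfc (heatSymbol t) (resolvent L (-1))

end UnboundedOp

/-! ## Operators on `ℓ²(V, m)` -/

/-- `L` is a restriction of the formal Laplacian `L̃`. -/
def IsRestrictionOfFormalLaplacian {V : Type*} [MeasurableSpace V] (G : WeightedGraph V)
    (m : V → ℝ) (L : WeightedL2 m →ₗ.[ℂ] WeightedL2 m) : Prop :=
  ∀ u : L.domain, ((u : WeightedL2 m) : V → ℂ) ∈ G.formalDomain ∧
    ∀ x, (L u : V → ℂ) x = G.formalLaplacian m ((u : WeightedL2 m) : V → ℂ) x

/-- A bounded operator is positivity preserving if it maps non-negative functions to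
non-negative functions. -/
def IsPositivityPreserving {V : Type*} [MeasurableSpace V] {m : V → ℝ}
    (A : WeightedL2 m →L[ℂ] WeightedL2 m) : Prop :=
  ∀ f : WeightedL2 m, (∀ x, 0 ≤ ((f : V → ℂ) x).re ∧ ((f : V → ℂ) x).im = 0) →
    ∀ x, 0 ≤ ((A f : V → ℂ) x).re ∧ ((A f : V → ℂ) x).im = 0

/-- The kernel of a bounded operator on `ℓ²(V, m)`: `A f (x) = ∑_y k(x, y) f(y) m(y)`. -/
def operatorKernel {V : Type*} [MeasurableSpace V] [DiscreteMeasurableSpace V] {m : V → ℝ}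
    (A : WeightedL2 m →L[ℂ] WeightedL2 m) (x y : V) : ℂ :=
  (A (pointFunction m y) : V → ℂ) x / (m y : ℂ)

/-- The heat kernel `p_t(x, y)`, i.e. the kernel of `e^{-tL}`. -/
def heatKernel {V : Type*} [MeasurableSpace V] [DiscreteMeasurableSpace V] {m : V → ℝ}
    (L : WeightedL2 m →ₗ.[ℂ] WeightedL2 m) (t : ℝ) (x y : V) : ℂ :=
  operatorKernel (UnboundedOp.heatSemigroup L t) x y

/-- The real-valued function `Φ` is (the pointwise form of) an eigenfunction of `L` to `E`, with
norm one in `ℓ²(V, m)`. -/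
def IsNormalizedEigenfunction {V : Type*} [MeasurableSpace V] {m : V → ℝ}
    (L : WeightedL2 m →ₗ.[ℂ] WeightedL2 m) (E : ℝ) (Φ : V → ℝ) : Prop :=
  ∃ u : L.domain, (∀ x, ((u : WeightedL2 m) : V → ℂ) x = (Φ x : ℂ)) ∧
    ‖(u : WeightedL2 m)‖ = 1 ∧ L u = (E : ℂ) • (u : WeightedL2 m)

theorem inner_pointFunction {V : Type*} [MeasurableSpace V] [DiscreteMeasurableSpace V]
    {m : V → ℝ} (hm : ∀ x, 0 < m x) (x : V) (f : WeightedL2 m) :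
    inner ℂ (pointFunction m x) f = (m x : ℂ) * (f : V → ℂ) x := by
  rw [pointFunction, L2.inner_indicatorConstLp_one, integral_singleton, Measure.real,
    discreteMeasure_singleton, ENNReal.toReal_ofReal (hm x).le]
  rfl

/-- The defining property of the kernel. -/
theorem hasSum_operatorKernel {V : Type*} [Countable V] [MeasurableSpace V]
    [DiscreteMeasurableSpace V] {m : V → ℝ} (hm : ∀ x, 0 < m x)
    (A : WeightedL2 m →L[ℂ] WeightedL2 m) (f : WeightedL2 m) (x : V) :
    HasSum (fun y => operatorKernel A x y * (f : V → ℂ) y * (m y : ℂ)) ((A f : V → ℂ) x) := by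
  have hmx : ∀ y, (m y : ℂ) ≠ 0 := fun y => by exact_mod_cast (hm y).ne'
  set g : WeightedL2 m := ContinuousLinearMap.adjoint A (pointFunction m x) with hg
  have h1 : inner ℂ g f = (m x : ℂ) * (A f : V → ℂ) x := by
    rw [hg, ContinuousLinearMap.adjoint_inner_left, inner_pointFunction hm]
  have h2 : HasSum (fun y => (m y : ℂ) * inner ℂ ((g : V → ℂ) y) ((f : V → ℂ) y))
      (inner ℂ g f) := by
    have hint : Integrable (fun y => inner ℂ ((g : V → ℂ) y) ((f : V → ℂ) y))
        (Measure.sum fun x => ENNReal.ofReal (m x) • Measure.dirac x) :=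
      L2.integrable_inner (𝕜 := ℂ) g f
    have h3 := hasSum_integral_measure hint
    have h4 : (∫ y, inner ℂ ((g : V → ℂ) y) ((f : V → ℂ) y)
        ∂(Measure.sum fun x => ENNReal.ofReal (m x) • Measure.dirac x)) = inner ℂ g f :=
      (L2.inner_def g f).symm
    rw [h4] at h3
    refine (congrArg (HasSum · (inner ℂ g f)) (funext fun y => ?_)).mp h3
    rw [integral_smul_measure, integral_dirac, ENNReal.toReal_ofReal (hm y).le]
    simp
  rw [h1] at h2
  have h5 := h2.mul_left ((m x : ℂ)⁻¹)
  rw [inv_mul_cancel_left₀ (hmx x)] at h5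
  refine (congrArg (HasSum · ((A f : V → ℂ) x)) (funext fun y => ?_)).mp h5
  have h6 : (m y : ℂ) * (g : V → ℂ) y
      = (starRingEnd ℂ) ((m x : ℂ) * (A (pointFunction m y) : V → ℂ) x) := by
    rw [← inner_pointFunction hm, ← inner_pointFunction hm, hg,
      ContinuousLinearMap.adjoint_inner_right, inner_conj_symm]
  have h7 : (starRingEnd ℂ) ((g : V → ℂ) y)
      = (m x : ℂ) * (A (pointFunction m y) : V → ℂ) x / (m y : ℂ) := by
    rw [eq_div_iff (hmx y), mul_comm]
    have := congrArg (starRingEnd ℂ) h6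
    simpa using this
  rw [RCLike.inner_apply, h7, operatorKernel]
  field_simp [hmx x, hmx y]

end

/-!
# Large time behaviour of heat kernels on graphs

Everything is read off from the bounded operator `R = (L + 1)⁻¹`, which is positive, injective and
of norm at most one. Inverting `L - z` amounts to inverting `1 - (z + 1) R`, so the bottom of the
spectrum is `E₀ = 1/‖R‖ - 1` and the eigenvectors of `L` to `E₀` are those of `R` to its largest
spectral value `‖R‖`. Each `e^{-tL}` is a continuous function of `R`; norm estimates of operators
are therefore elementary estimates of functions on `[0, ‖R‖]`.

*Convergence.* The functional calculus gives `‖(‖R‖ - R) e^{tE₀} e^{-tL}‖ = O(1/t)`. As the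
orthogonal complement of `ker (‖R‖ - R)` is the closure of the range of `‖R‖ - R`, the contractions
`e^{tE₀} e^{-tL}` tend strongly to zero there (`tendsto_heatSemigroup_zero`), whereas they fix
`ker (‖R‖ - R)` pointwise. Hence they converge strongly to the projection onto the eigenspace to
`E₀`, which may be zero.

*Strict positivity.* If `p_t(x, y) = 0`, then `s ↦ p_s(x, y)` has a minimum at `s = t`, so its
left derivative `-L̃ p_t(·, y)(x) = m(x)⁻¹ ∑_z b(x, z) p_t(z, y)` is not positive; all its
terms are non-negative, so `p_t(·, y)` vanishes at the neighbours of `x`, and by connectedness at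
`y`. This contradicts `m(y)² p_t(y, y) = ‖e^{-(t/2)L} δ_y‖² > 0` (`heatKernel_pos`).

*Ground state.* If `f` is an eigenfunction to `E₀`, then positivity gives
`e^{-tE₀} |f| ≤ e^{-tL} |f|`, and comparison of norms turns this into an equality
(`resolvent_modulus`). So `|f|` is an eigenfunction as well, strictly positive by strict positivity
of the kernel. Hence an eigenfunction that vanishes at one point is zero, the eigenspace is
one-dimensional, and it is spanned by a strictly positive function `Φ`; the limit kernel is
`Φ(x) Φ(y)`.

*Rate.* The upper bound is `‖e^{-tL}‖ = e^{-tE₀}`. If `m(x) p_t(x, x) < e^{-tE}` held for some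
`E > E₀` and all `t`, then strict positivity of `p_1` would carry this decay to all `δ_y`, and by
logarithmic convexity of `t ↦ ‖e^{-tL} f‖` to the operator norm (`norm_heatSemigroup_le_of_dense`),
which is impossible. So `m(x) p_t(x, x) ≥ e^{-tE}` for some `t`, and supermultiplicativity and
monotonicity of `t ↦ p_t(x, x)` extend the bound to all large times
(`exists_heatKernel_diag_lower_bound`).
-/

/-! ### The resolvent at `-1` -/

namespace UnboundedOp

variable {H : Type*} [NormedAddCommGroup H] [InnerProductSpace ℂ H] [CompleteSpace H]
  {L : H →ₗ.[ℂ] H}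

theorem resolvent_mem_domain (hsa : IsSelfAdjoint L) (hpos : IsNonnegative L) (f : H) :
    resolvent L (-1) f ∈ L.domain :=
  ((resolvent_spec hsa hpos).1 f).1

theorem apply_resolvent (hsa : IsSelfAdjoint L) (hpos : IsNonnegative L) (f : H)
    (h : resolvent L (-1) f ∈ L.domain) :
    L ⟨resolvent L (-1) f, h⟩ = f - resolvent L (-1) f := by
  obtain ⟨h', hf⟩ := (resolvent_spec hsa hpos).1 f
  rw [neg_one_smul, sub_neg_eq_add] at hf
  exact eq_sub_of_add_eq hf

theorem resolvent_apply (hsa : IsSelfAdjoint L) (hpos : IsNonnegative L) (u : L.domain) :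
    resolvent L (-1) (L u + (u : H)) = u := by
  have := (resolvent_spec hsa hpos).2 u
  rwa [neg_one_smul, sub_neg_eq_add] at this

theorem resolvent_eq_zero_iff (hsa : IsSelfAdjoint L) (hpos : IsNonnegative L) {f : H} :
    resolvent L (-1) f = 0 ↔ f = 0 := by
  refine ⟨fun h => ?_, fun h => by rw [h, map_zero]⟩
  have h1 := apply_resolvent hsa hpos f (resolvent_mem_domain hsa hpos f)
  have h2 : (⟨resolvent L (-1) f, resolvent_mem_domain hsa hpos f⟩ : L.domain) = 0 :=
    Subtype.ext h
  rw [h2, LinearPMap.map_zero, h, sub_zero] at h1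
  exact h1.symm

theorem isPositive_resolvent (hsa : IsSelfAdjoint L) (hpos : IsNonnegative L) :
    (resolvent L (-1)).IsPositive := by
  have key : ∀ f : H, 0 ≤ (inner ℂ (resolvent L (-1) f) f).re ∧
      (inner ℂ (resolvent L (-1) f) f).im = 0 := by
    intro f
    have h := hpos ⟨resolvent L (-1) f, resolvent_mem_domain hsa hpos f⟩
    rw [apply_resolvent hsa hpos, inner_sub_right] at h
    have h1 : (inner ℂ (resolvent L (-1) f) (resolvent L (-1) f)).im = 0 :=
      inner_self_im (𝕜 := ℂ) _
    have h2 : 0 ≤ (inner ℂ (resolvent L (-1) f) (resolvent L (-1) f)).re :=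
      inner_self_nonneg (𝕜 := ℂ)
    simp only [Complex.sub_re, Complex.sub_im] at h
    exact ⟨by linarith, by linarith⟩
  rw [ContinuousLinearMap.isPositive_iff_complex]
  refine fun f => ⟨?_, (key f).1⟩
  apply Complex.ext
  · simp
  · simpa using (key f).2.symm

theorem resolvent_isSelfAdjoint (hsa : IsSelfAdjoint L) (hpos : IsNonnegative L) :
    IsSelfAdjoint (resolvent L (-1)) :=
  (isPositive_resolvent hsa hpos).isSelfAdjoint

/-- The spectral mapping between `L` and its resolvent at `-1`: since
`L - z = (1 - (z + 1) (L + 1)⁻¹) (L + 1)`, inverting `L - z` amounts to inverting the bounded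
operator `1 - (z + 1) (L + 1)⁻¹`. -/
theorem mem_spectrum_iff_resolvent (hsa : IsSelfAdjoint L) (hpos : IsNonnegative L) (z : ℂ) :
    z ∈ spectrum L ↔ z ≠ -1 ∧ (z + 1)⁻¹ ∈ _root_.spectrum ℂ (resolvent L (-1)) := by
  set R := resolvent L (-1) with hR
  by_cases hz : z = -1
  · simp only [hz, ne_eq, not_true_eq_false, false_and, iff_false, spectrum, Set.mem_ofPred_eq,
      not_not]
    exact exists_isResolventAt_neg_one hsa hpos
  have hz1 : z + 1 ≠ 0 := fun h => hz (eq_neg_of_add_eq_zero_left h)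
  have hunit : (z + 1)⁻¹ ∈ _root_.spectrum ℂ R ↔ ¬ IsUnit (1 - (z + 1) • R) := by
    rw [_root_.spectrum.mem_iff, not_iff_not]
    have : algebraMap ℂ (H →L[ℂ] H) (z + 1)⁻¹ - R
        = (Units.mk0 _ hz1)⁻¹ • (1 - (z + 1) • R) := by
      rw [Units.smul_def, smul_sub, smul_smul]
      simp [hz1, Algebra.algebraMap_eq_smul_one]
    rw [this]
    exact isUnit_smul_iff _ _
  rw [hunit, spectrum, Set.mem_ofPred_eq]
  simp only [ne_eq, hz, not_false_eq_true, true_and, not_iff_not]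
  have hdom := resolvent_mem_domain hsa hpos
  constructor
  · rintro ⟨S, hS⟩
    have hcomm : ∀ f, S f - R f = (z + 1) • S (R f) := by
      intro f
      have := hS.2 ⟨R f, hdom f⟩
      rw [apply_resolvent hsa hpos] at this
      simp only [map_sub, map_smul] at this
      linear_combination (norm := module) this
    have hcomm' : ∀ f, S f - R f = (z + 1) • R (S f) := by
      intro f
      obtain ⟨h, hf⟩ := hS.1 f
      have := resolvent_apply hsa hpos ⟨S f, h⟩
      rw [eq_add_of_sub_eq hf] at this
      simp only [map_add, map_smul] at this
      linear_combination (norm := module) -this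
    refine isUnit_iff_exists.mpr ⟨1 + (z + 1) • S, ?_, ?_⟩
    · ext f
      change (f + (z + 1) • S f) - (z + 1) • R (f + (z + 1) • S f) = f
      simp only [map_add, map_smul]
      linear_combination (norm := module) (z + 1) • hcomm' f
    · ext f
      change (f - (z + 1) • R f) + (z + 1) • S (f - (z + 1) • R f) = f
      simp only [map_sub, map_smul]
      linear_combination (norm := module) (z + 1) • hcomm f
  · rintro ⟨U, hU⟩
    have h1 : ∀ f, (U⁻¹ : (H →L[ℂ] H)ˣ).val f - (z + 1) • R ((U⁻¹ : (H →L[ℂ] H)ˣ).val f) = f := by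
      intro f
      have : (U.val * (U⁻¹ : (H →L[ℂ] H)ˣ).val) f = f := by rw [Units.mul_inv]; rfl
      rw [hU] at this
      simpa using this
    have h2 : ∀ f, (U⁻¹ : (H →L[ℂ] H)ˣ).val (f - (z + 1) • R f) = f := by
      intro f
      have : ((U⁻¹ : (H →L[ℂ] H)ˣ).val * U.val) f = f := by rw [Units.inv_mul]; rfl
      rw [hU] at this
      simpa using this
    refine ⟨R * (U⁻¹ : (H →L[ℂ] H)ˣ).val, fun f => ⟨hdom _, ?_⟩, fun u => ?_⟩
    · change L ⟨R ((U⁻¹ : (H →L[ℂ] H)ˣ).val f), hdom _⟩ - z • R ((U⁻¹ : (H →L[ℂ] H)ˣ).val f) = f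
      rw [apply_resolvent hsa hpos]
      linear_combination (norm := module) h1 f
    · change R ((U⁻¹ : (H →L[ℂ] H)ˣ).val (L u - z • (u : H))) = u
      have h3 := resolvent_apply hsa hpos u
      have h4 : L u - z • (u : H) = (L u + u) - (z + 1) • R (L u + u) := by
        rw [h3]; module
      rw [h4, h2, h3]

theorem mem_realSpectrum_iff_resolvent (hsa : IsSelfAdjoint L) (hpos : IsNonnegative L) (s : ℝ) :
    s ∈ realSpectrum L ↔ s ≠ -1 ∧ (s + 1)⁻¹ ∈ _root_.spectrum ℝ (resolvent L (-1)) := by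
  rw [realSpectrum, Set.mem_ofPred_eq, mem_spectrum_iff_resolvent hsa hpos,
    ← _root_.spectrum.algebraMap_mem_iff ℂ (r := (s + 1)⁻¹)]
  have h1 : (s : ℂ) ≠ -1 ↔ s ≠ -1 := by
    rw [not_iff_not]; exact_mod_cast Iff.rfl
  rw [h1]
  push_cast [Complex.coe_algebraMap]
  rfl

theorem spectrum_resolvent_subset [Nontrivial H] (hsa : IsSelfAdjoint L) (hpos : IsNonnegative L) :
    _root_.spectrum ℝ (resolvent L (-1)) ⊆ Set.Icc 0 ‖resolvent L (-1)‖ := by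
  intro r hr
  have h0 : 0 ≤ resolvent L (-1) :=
    (ContinuousLinearMap.nonneg_iff_isPositive _).mpr (isPositive_resolvent hsa hpos)
  refine ⟨spectrum_nonneg_of_nonneg h0 hr, ?_⟩
  exact (le_abs_self r).trans (_root_.spectrum.norm_le_norm_of_mem hr)

theorem norm_resolvent_mem_spectrum [Nontrivial H] (hsa : IsSelfAdjoint L)
    (hpos : IsNonnegative L) :
    ‖resolvent L (-1)‖ ∈ _root_.spectrum ℝ (resolvent L (-1)) :=
  CStarAlgebra.norm_mem_spectrum_of_nonneg
    ((ContinuousLinearMap.nonneg_iff_isPositive _).mpr (isPositive_resolvent hsa hpos))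

theorem norm_resolvent_pos [Nontrivial H] (hsa : IsSelfAdjoint L) (hpos : IsNonnegative L) :
    0 < ‖resolvent L (-1)‖ := by
  rw [norm_pos_iff]
  intro h
  obtain ⟨f, hf⟩ := exists_ne (0 : H)
  exact hf ((resolvent_eq_zero_iff hsa hpos).mp (by rw [h]; rfl))

/-- The bottom of the spectrum of `L` corresponds to the largest spectral value `‖(L + 1)⁻¹‖` of
the resolvent at `-1`. -/
theorem isLeast_realSpectrum [Nontrivial H] (hsa : IsSelfAdjoint L) (hpos : IsNonnegative L) :
    IsLeast (realSpectrum L) (‖resolvent L (-1)‖⁻¹ - 1) := by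
  have h0 := norm_resolvent_pos hsa hpos
  constructor
  · rw [mem_realSpectrum_iff_resolvent hsa hpos]
    refine ⟨fun h => (inv_pos.mpr h0).ne' (by linarith), ?_⟩
    rw [sub_add_cancel, inv_inv]
    exact norm_resolvent_mem_spectrum hsa hpos
  · intro s hs
    obtain ⟨h1, h2⟩ := (mem_realSpectrum_iff_resolvent hsa hpos s).mp hs
    have h3 := spectrum_resolvent_subset hsa hpos h2
    have h4 : 0 < s + 1 := by
      refine lt_of_le_of_ne (inv_nonneg.mp h3.1) fun h => h1 (by linarith)
    have h5 := (inv_le_comm₀ h4 h0).mp h3.2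
    linarith

theorem bottom_eq [Nontrivial H] (hsa : IsSelfAdjoint L) (hpos : IsNonnegative L) :
    bottom L = ‖resolvent L (-1)‖⁻¹ - 1 :=
  (isLeast_realSpectrum hsa hpos).csInf_eq

/-- The eigenvectors of `L` to the bottom of its spectrum are those of the resolvent to its
norm. -/
theorem eigen_bottom_iff [Nontrivial H] (hsa : IsSelfAdjoint L) (hpos : IsNonnegative L) (v : H) :
    (∃ h : v ∈ L.domain, L ⟨v, h⟩ = (bottom L : ℂ) • v) ↔
      resolvent L (-1) v = (‖resolvent L (-1)‖ : ℂ) • v := by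
  have h0 : (‖resolvent L (-1)‖ : ℂ) ≠ 0 := by exact_mod_cast (norm_resolvent_pos hsa hpos).ne'
  have hE : (bottom L : ℂ) + 1 = (‖resolvent L (-1)‖ : ℂ)⁻¹ := by
    rw [bottom_eq hsa hpos]
    simp
  constructor
  · rintro ⟨h, hv⟩
    have h1 := resolvent_apply hsa hpos ⟨v, h⟩
    have h2 : L ⟨v, h⟩ + v = (‖resolvent L (-1)‖ : ℂ)⁻¹ • v := by
      rw [hv, ← hE, add_smul, one_smul]
    change resolvent L (-1) (L ⟨v, h⟩ + v) = v at h1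
    rw [h2, map_smul] at h1
    conv_rhs => rw [← h1, smul_smul, mul_inv_cancel₀ h0, one_smul]
  · intro hv
    have h1 : v = resolvent L (-1) ((‖resolvent L (-1)‖ : ℂ)⁻¹ • v) := by
      rw [map_smul, hv, smul_smul, inv_mul_cancel₀ h0, one_smul]
    have hd : v ∈ L.domain := by rw [h1]; exact resolvent_mem_domain hsa hpos _
    refine ⟨hd, ?_⟩
    have h2 := apply_resolvent hsa hpos _ (resolvent_mem_domain hsa hpos
      ((‖resolvent L (-1)‖ : ℂ)⁻¹ • v))
    simp only [← h1] at h2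
    rw [h2, ← hE, add_smul, one_smul, add_sub_cancel_right]

end UnboundedOp

/-! ### The heat symbol -/

namespace UnboundedOp

theorem heatSymbol_of_pos (t : ℝ) {r : ℝ} (hr : 0 < r) :
    heatSymbol t r = Real.exp (-t * (r⁻¹ - 1)) := by
  rw [heatSymbol, if_neg hr.not_ge]

theorem heatSymbol_of_nonpos (t : ℝ) {r : ℝ} (hr : r ≤ 0) : heatSymbol t r = 0 := by
  rw [heatSymbol, if_pos hr]

theorem heatSymbol_add (s t r : ℝ) :
    heatSymbol (s + t) r = heatSymbol s r * heatSymbol t r := by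
  rcases le_or_gt r 0 with hr | hr
  · simp [heatSymbol_of_nonpos _ hr]
  · rw [heatSymbol_of_pos _ hr, heatSymbol_of_pos _ hr, heatSymbol_of_pos _ hr, ← Real.exp_add]
    congr 1
    ring

/-- The heat symbol is a rescaling of the smooth function `r ↦ exp (-1 / r)`. -/
theorem heatSymbol_eq_expNegInvGlue {t : ℝ} (ht : 0 < t) (r : ℝ) :
    heatSymbol t r = Real.exp t * expNegInvGlue (r / t) := by
  rcases le_or_gt r 0 with hr | hr
  · rw [heatSymbol_of_nonpos _ hr, expNegInvGlue.zero_of_nonpos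
      (div_nonpos_of_nonpos_of_nonneg hr ht.le), mul_zero]
  · rw [heatSymbol_of_pos _ hr, expNegInvGlue, if_neg (div_pos hr ht).not_ge, ← Real.exp_add]
    congr 1
    rw [inv_div]
    ring

theorem continuous_heatSymbol {t : ℝ} (ht : 0 < t) : Continuous (heatSymbol t) := by
  have h : heatSymbol t = fun r => Real.exp t * expNegInvGlue (r / t) :=
    funext (heatSymbol_eq_expNegInvGlue ht)
  rw [h]
  have := (expNegInvGlue.contDiff (n := 0)).continuous
  fun_prop

theorem differentiableAt_heatSymbol (t : ℝ) {r : ℝ} (hr : 0 < r) :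
    DifferentiableAt ℝ (heatSymbol t) r := by
  have h : heatSymbol t =ᶠ[𝓝 r] fun r => Real.exp (-t * (r⁻¹ - 1)) := by
    filter_upwards [lt_mem_nhds hr] with x hx using heatSymbol_of_pos t hx
  rw [h.differentiableAt_iff]
  have := hr.ne'
  fun_prop (disch := assumption)

theorem continuous_inv_mul_heatSymbol {t : ℝ} (ht : 0 < t) :
    Continuous fun r => r⁻¹ * heatSymbol t r := by
  have h : (fun r => r⁻¹ * heatSymbol t r) = fun r => (Real.exp t / t) *
      (Polynomial.X.eval (r / t)⁻¹ * expNegInvGlue (r / t)) := by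
    funext r
    rw [heatSymbol_eq_expNegInvGlue ht, Polynomial.eval_X, inv_div]
    field_simp
  rw [h]
  exact continuous_const.mul ((expNegInvGlue.continuous_polynomial_eval_inv_mul Polynomial.X).comp
    (continuous_id.div_const t))

theorem heatSymbol_nonneg (t r : ℝ) : 0 ≤ heatSymbol t r := by
  rw [heatSymbol]
  split_ifs
  · exact le_rfl
  · exact (Real.exp_pos _).le

theorem heatSymbol_le {t : ℝ} (ht : 0 < t) {r r₀ : ℝ} (hr : r ≤ r₀) :
    heatSymbol t r ≤ Real.exp (-t * (r₀⁻¹ - 1)) := by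
  rcases le_or_gt r 0 with h | h
  · rw [heatSymbol_of_nonpos _ h]
    exact (Real.exp_pos _).le
  · rw [heatSymbol_of_pos _ h, Real.exp_le_exp, neg_mul, neg_mul, neg_le_neg_iff]
    gcongr

/-- The elementary inequality `d e^{-td} ≤ 1/t`, for `d = 1/r - 1/r₀`. -/
theorem abs_sub_mul_heatSymbol_le {t : ℝ} (ht : 0 < t) {r r₀ : ℝ} (h0 : 0 ≤ r) (hr : r ≤ r₀) :
    |(r₀ - r) * heatSymbol t r| ≤ r₀ ^ 2 / t * Real.exp (-t * (r₀⁻¹ - 1)) := by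
  rcases h0.eq_or_lt with h | h
  · rw [heatSymbol_of_nonpos _ h.ge, mul_zero, abs_zero]
    positivity
  have hr0 : 0 < r₀ := h.trans_le hr
  rw [abs_of_nonneg (mul_nonneg (sub_nonneg.mpr hr) (heatSymbol_nonneg _ _)),
    heatSymbol_of_pos _ h]
  set d := r⁻¹ - r₀⁻¹ with hd
  have hd0 : 0 ≤ d := sub_nonneg.mpr (by gcongr)
  have h1 : r₀ - r ≤ r₀ ^ 2 * d := by
    have : r₀ ^ 2 * d - (r₀ - r) = (r₀ - r) ^ 2 / r := by
      rw [hd]; field_simp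
    have h2 : 0 ≤ (r₀ - r) ^ 2 / r := by positivity
    linarith
  have h3 : Real.exp (-t * (r⁻¹ - 1)) = Real.exp (-(t * d)) * Real.exp (-t * (r₀⁻¹ - 1)) := by
    rw [← Real.exp_add]; congr 1; rw [hd]; ring
  have h4 : t * d * Real.exp (-(t * d)) ≤ 1 := by
    rw [Real.exp_neg, ← div_eq_mul_inv, div_le_one (Real.exp_pos _)]
    linarith [Real.add_one_le_exp (t * d)]
  rw [h3, ← mul_assoc]
  gcongr
  calc (r₀ - r) * Real.exp (-(t * d)) ≤ r₀ ^ 2 * d * Real.exp (-(t * d)) := by gcongr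
    _ = r₀ ^ 2 / t * (t * d * Real.exp (-(t * d))) := by field_simp
    _ ≤ r₀ ^ 2 / t * 1 := by gcongr
    _ = r₀ ^ 2 / t := mul_one _

/-- A second order Taylor estimate for `t ↦ e^{-ts}`, uniform in `s = 1/r - 1 ≥ 0`. -/
theorem abs_heatSymbol_sub_le {t ε r : ℝ} (hε : 0 < ε) (hεt : ε ≤ t / 2) (h0 : 0 ≤ r)
    (h1 : r ≤ 1) :
    |heatSymbol (t - ε) r - heatSymbol t r - ε * ((r⁻¹ - 1) * heatSymbol t r)| ≤
      8 / t ^ 2 * ε ^ 2 := by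
  have ht : 0 < t := by linarith
  rcases h0.eq_or_lt with h | h
  · simp only [heatSymbol_of_nonpos _ h.ge, mul_zero, sub_zero, abs_zero]
    positivity
  rw [heatSymbol_of_pos _ h, heatSymbol_of_pos _ h]
  set s := r⁻¹ - 1 with hs
  have hs0 : 0 ≤ s := sub_nonneg.mpr ((one_le_inv₀ h).mpr h1)
  have e1 : Real.exp (-(t - ε) * s) - Real.exp (-t * s) - ε * (s * Real.exp (-t * s)) =
      (Real.exp (ε * s) - 1 - ε * s) * Real.exp (-t * s) := by
    have : Real.exp (-(t - ε) * s) = Real.exp (ε * s) * Real.exp (-t * s) := by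
      rw [← Real.exp_add]; congr 1; ring
    rw [this]; ring
  have h2 : |Real.exp (ε * s) - 1 - ε * s| ≤ (ε * s) ^ 2 * Real.exp (ε * s) := by
    have := Complex.norm_exp_sub_sum_le_norm_mul_exp ((ε * s : ℝ) : ℂ) 2
    simp only [Finset.sum_range_succ, Finset.range_zero, Finset.sum_empty, pow_zero, pow_one,
      Nat.factorial, zero_add, Nat.cast_one, div_one, mul_one] at this
    rw [Complex.norm_real, Real.norm_of_nonneg (by positivity)] at this
    rw [← Real.norm_eq_abs, ← Complex.norm_real]
    refine le_trans (le_of_eq ?_) this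
    congr 1
    push_cast
    ring
  have h3 : s ^ 2 * Real.exp (-(t * s / 2)) ≤ 8 / t ^ 2 := by
    have h4 := Real.quadratic_le_exp_of_nonneg (x := t * s / 2) (by positivity)
    rw [Real.exp_neg, ← div_eq_mul_inv, div_le_div_iff₀ (Real.exp_pos _) (by positivity)]
    have : 0 ≤ t * s := by positivity
    nlinarith
  rw [e1, abs_mul, abs_of_pos (Real.exp_pos (-t * s))]
  calc |Real.exp (ε * s) - 1 - ε * s| * Real.exp (-t * s)
      ≤ (ε * s) ^ 2 * Real.exp (ε * s) * Real.exp (-t * s) := by gcongr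
    _ = ε ^ 2 * (s ^ 2 * Real.exp (ε * s + -t * s)) := by rw [Real.exp_add]; ring
    _ ≤ ε ^ 2 * (s ^ 2 * Real.exp (-(t * s / 2))) := by
        gcongr
        nlinarith
    _ ≤ ε ^ 2 * (8 / t ^ 2) := by gcongr
    _ = 8 / t ^ 2 * ε ^ 2 := mul_comm _ _

/-- The quantitative form of `e^{-ts} → 1` as `t → 0`, weighted by `r = 1/(s + 1)`. -/
theorem abs_heatSymbol_sub_one_mul_le {t r : ℝ} (ht : 0 < t) (h0 : 0 ≤ r) (h1 : r ≤ 1) :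
    |(1 - heatSymbol t r) * r| ≤ t := by
  rcases h0.eq_or_lt with h | h
  · rw [← h, mul_zero, abs_zero]
    exact ht.le
  have h2 : heatSymbol t r ≤ 1 := by simpa using heatSymbol_le ht h1
  rw [abs_of_nonneg (mul_nonneg (sub_nonneg.mpr h2) h0), heatSymbol_of_pos _ h]
  have h3 := Real.add_one_le_exp (-t * (r⁻¹ - 1))
  calc (1 - Real.exp (-t * (r⁻¹ - 1))) * r ≤ (t * (r⁻¹ - 1)) * r := by gcongr; linarith
    _ = t * (1 - r) := by field_simp
    _ ≤ t := by nlinarith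

end UnboundedOp

/-! ### The heat semigroup in Hilbert space -/

/-- An eigenvector of a self-adjoint operator `a` is an eigenvector of each `f(a)`, at least if
`f` is differentiable at the eigenvalue `c`: then `f - f(c)` is divisible by `r - c` among the
continuous functions. -/
theorem cfc_apply_eq_smul_of_eigenvector {H : Type*} [NormedAddCommGroup H]
    [InnerProductSpace ℂ H] [CompleteSpace H] {a : H →L[ℂ] H} (ha : IsSelfAdjoint a)
    {f : ℝ → ℝ} (hf : Continuous f) {c : ℝ} (hfc : DifferentiableAt ℝ f c) {v : H}
    (hv : a v = (c : ℂ) • v) : cfc f a v = (f c : ℂ) • v := by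
  have hg : Continuous (dslope f c) := by
    rw [← continuousOn_univ, continuousOn_dslope univ_mem]
    exact ⟨hf.continuousOn, hfc⟩
  have h1 : f = fun r => dslope f c r * (r - c) + f c := by
    funext r
    have := sub_smul_dslope f c r
    rw [smul_eq_mul] at this
    linarith
  have h2 : cfc f a = cfc (dslope f c) a * (a - algebraMap ℝ _ c) + algebraMap ℝ _ (f c) := by
    conv_lhs => rw [h1]
    rw [cfc_add_const _ _ _ (by fun_prop), cfc_mul _ _ _ hg.continuousOn (by fun_prop),
      cfc_sub _ _ _ (by fun_prop) (by fun_prop), cfc_const c a, cfc_id' ℝ a]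
  rw [h2]
  change cfc (dslope f c) a (a v - (c : ℂ) • v) + (f c : ℂ) • v = (f c : ℂ) • v
  rw [hv, sub_self, map_zero, zero_add]

namespace UnboundedOp

variable {H : Type*} [NormedAddCommGroup H] [InnerProductSpace ℂ H] [CompleteSpace H]
  {L : H →ₗ.[ℂ] H}

theorem norm_resolvent_le_one (hsa : IsSelfAdjoint L) (hpos : IsNonnegative L) :
    ‖resolvent L (-1)‖ ≤ 1 := by
  refine ContinuousLinearMap.opNorm_le_bound _ zero_le_one fun f => ?_
  set u := resolvent L (-1) f with hu
  have h := (hpos ⟨u, resolvent_mem_domain hsa hpos f⟩).1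
  rw [apply_resolvent hsa hpos, inner_sub_right, Complex.sub_re] at h
  have h1 : (inner ℂ u u).re = ‖u‖ * ‖u‖ := inner_self_eq_norm_mul_norm (𝕜 := ℂ) u
  have h2 : (inner ℂ u f).re ≤ ‖u‖ * ‖f‖ := (Complex.re_le_norm _).trans (norm_inner_le_norm u f)
  have h3 : ‖u‖ * ‖u‖ ≤ ‖u‖ * ‖f‖ := by
    change 0 ≤ (inner ℂ u f).re - (inner ℂ u u).re at h
    linarith
  rw [one_mul]
  rcases (norm_nonneg u).eq_or_lt with h0 | h0
  · rw [← h0]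
    exact norm_nonneg f
  · exact le_of_mul_le_mul_left h3 h0

theorem spectrum_resolvent_bounds [Nontrivial H] (hsa : IsSelfAdjoint L)
    (hpos : IsNonnegative L) {r : ℝ} (hr : r ∈ _root_.spectrum ℝ (resolvent L (-1))) :
    0 ≤ r ∧ r ≤ ‖resolvent L (-1)‖ ∧ r ≤ 1 :=
  have h := spectrum_resolvent_subset hsa hpos hr
  ⟨h.1, h.2, h.2.trans (norm_resolvent_le_one hsa hpos)⟩

theorem heatSemigroup_of_pos {t : ℝ} (ht : 0 < t) :
    heatSemigroup L t = cfc (heatSymbol t) (resolvent L (-1)) := by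
  rw [heatSemigroup, if_neg ht.ne']

theorem heatSemigroup_add {s t : ℝ} (hs : 0 < s) (ht : 0 < t) :
    heatSemigroup L (s + t) = heatSemigroup L s * heatSemigroup L t := by
  rw [heatSemigroup_of_pos hs, heatSemigroup_of_pos ht, heatSemigroup_of_pos (add_pos hs ht),
    ← cfc_mul _ _ _ (continuous_heatSymbol hs).continuousOn (continuous_heatSymbol ht).continuousOn]
  exact congrArg (fun f => cfc f (resolvent L (-1))) (funext (heatSymbol_add s t))

theorem heatSemigroup_add_apply {s t : ℝ} (hs : 0 < s) (ht : 0 < t) (f : H) :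
    heatSemigroup L (s + t) f = heatSemigroup L s (heatSemigroup L t f) := by
  rw [heatSemigroup_add hs ht]
  rfl

theorem inner_heatSemigroup_left {t : ℝ} (ht : 0 < t) (f g : H) :
    inner ℂ (heatSemigroup L t f) g = inner ℂ f (heatSemigroup L t g) := by
  have h : IsSelfAdjoint (heatSemigroup L t) := by
    rw [heatSemigroup_of_pos ht]
    exact cfc_predicate _ _
  exact ContinuousLinearMap.isSelfAdjoint_iff_isSymmetric.mp h f g

theorem inner_heatSemigroup_add_self {t : ℝ} (ht : 0 < t) (f : H) :
    inner ℂ f (heatSemigroup L (t + t) f) = (‖heatSemigroup L t f‖ : ℂ) ^ 2 := by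
  rw [heatSemigroup_add_apply ht ht, ← inner_heatSemigroup_left ht]
  exact inner_self_eq_norm_sq_to_K _

theorem norm_heatSemigroup [Nontrivial H] (hsa : IsSelfAdjoint L) (hpos : IsNonnegative L)
    {t : ℝ} (ht : 0 < t) : ‖heatSemigroup L t‖ = Real.exp (-t * bottom L) := by
  have hR := resolvent_isSelfAdjoint hsa hpos
  rw [heatSemigroup_of_pos ht, bottom_eq hsa hpos]
  apply le_antisymm
  · refine norm_cfc_le (Real.exp_pos _).le fun r hr => ?_
    rw [Real.norm_of_nonneg (heatSymbol_nonneg _ _)]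
    exact heatSymbol_le ht (spectrum_resolvent_bounds hsa hpos hr).2.1
  · have := norm_apply_le_norm_cfc (heatSymbol t) _ (norm_resolvent_mem_spectrum hsa hpos)
      (continuous_heatSymbol ht).continuousOn hR
    rwa [Real.norm_of_nonneg (heatSymbol_nonneg _ _),
      heatSymbol_of_pos _ (norm_resolvent_pos hsa hpos)] at this

theorem norm_heatSemigroup_apply_le [Nontrivial H] (hsa : IsSelfAdjoint L)
    (hpos : IsNonnegative L) {t : ℝ} (ht : 0 < t) (f : H) :
    ‖heatSemigroup L t f‖ ≤ Real.exp (-t * bottom L) * ‖f‖ := by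
  rw [← norm_heatSemigroup hsa hpos ht]
  exact ContinuousLinearMap.le_opNorm _ _

theorem heatSemigroup_apply_of_eigenvector [Nontrivial H] (hsa : IsSelfAdjoint L)
    (hpos : IsNonnegative L) {t : ℝ} (ht : 0 < t) {v : H}
    (hv : resolvent L (-1) v = (‖resolvent L (-1)‖ : ℂ) • v) :
    heatSemigroup L t v = (Real.exp (-t * bottom L) : ℂ) • v := by
  have h0 := norm_resolvent_pos hsa hpos
  rw [heatSemigroup_of_pos ht, cfc_apply_eq_smul_of_eigenvector (resolvent_isSelfAdjoint hsa hpos)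
    (continuous_heatSymbol ht) (differentiableAt_heatSymbol t h0) hv, heatSymbol_of_pos _ h0,
    bottom_eq hsa hpos]

/-- The rescaled semigroup `e^{t E₀} e^{-tL}` concentrates near the bottom of the spectrum. -/
theorem norm_smul_sub_resolvent_heatSemigroup_le [Nontrivial H] (hsa : IsSelfAdjoint L)
    (hpos : IsNonnegative L) {t : ℝ} (ht : 0 < t) (f : H) :
    ‖(‖resolvent L (-1)‖ : ℂ) • heatSemigroup L t f - resolvent L (-1) (heatSemigroup L t f)‖ ≤
      ‖resolvent L (-1)‖ ^ 2 / t * Real.exp (-t * bottom L) * ‖f‖ := by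
  have hR := resolvent_isSelfAdjoint hsa hpos
  set r₀ := ‖resolvent L (-1)‖ with hr0
  have h1 : cfc (fun r => (r₀ - r) * heatSymbol t r) (resolvent L (-1)) =
      (algebraMap ℝ _ r₀ - resolvent L (-1)) * heatSemigroup L t := by
    rw [cfc_mul _ _ _ (by fun_prop) (continuous_heatSymbol ht).continuousOn,
      cfc_sub _ _ _ (by fun_prop) (by fun_prop), cfc_const r₀ _, cfc_id' ℝ (resolvent L (-1)),
      heatSemigroup_of_pos ht]
  have h2 : ‖(algebraMap ℝ _ r₀ - resolvent L (-1)) * heatSemigroup L t‖ ≤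
      r₀ ^ 2 / t * Real.exp (-t * bottom L) := by
    rw [← h1, bottom_eq hsa hpos]
    refine norm_cfc_le (by positivity) fun r hr => ?_
    have h3 := spectrum_resolvent_bounds hsa hpos hr
    exact abs_sub_mul_heatSymbol_le ht h3.1 h3.2.1
  exact ((algebraMap ℝ _ r₀ - resolvent L (-1)) * heatSemigroup L t).le_of_opNorm_le h2 f

theorem heatSemigroup_resolvent_comm (hsa : IsSelfAdjoint L) (hpos : IsNonnegative L)
    {t : ℝ} (ht : 0 < t) (f : H) :
    heatSemigroup L t (resolvent L (-1) f) = resolvent L (-1) (heatSemigroup L t f) := by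
  have h : Commute (cfc (heatSymbol t) (resolvent L (-1))) (resolvent L (-1)) := by
    have := cfc_commute_cfc (heatSymbol t) (fun r : ℝ => r) (resolvent L (-1))
    rwa [cfc_id' ℝ (resolvent L (-1)) (resolvent_isSelfAdjoint hsa hpos)] at this
  rw [heatSemigroup_of_pos ht]
  exact congrArg (fun T : H →L[ℂ] H => T f) h

/-- A vector fixed by the whole rescaled semigroup is an eigenvector to the bottom. -/
theorem resolvent_apply_of_forall_heatSemigroup [Nontrivial H] (hsa : IsSelfAdjoint L)
    (hpos : IsNonnegative L) {v : H}
    (hv : ∀ t : ℝ, 0 < t → heatSemigroup L t v = (Real.exp (-t * bottom L) : ℂ) • v) :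
    resolvent L (-1) v = (‖resolvent L (-1)‖ : ℂ) • v := by
  have h : ∀ t : ℝ, 0 < t → ‖(‖resolvent L (-1)‖ : ℂ) • v - resolvent L (-1) v‖ ≤
      (‖resolvent L (-1)‖ ^ 2 * ‖v‖) / t := by
    intro t ht
    have h1 := norm_smul_sub_resolvent_heatSemigroup_le hsa hpos ht v
    rw [hv t ht, map_smul, smul_comm, ← smul_sub, norm_smul,
      Complex.norm_real, Real.norm_of_nonneg (Real.exp_pos _).le] at h1
    refine le_of_mul_le_mul_left (h1.trans_eq ?_) (Real.exp_pos (-t * bottom L))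
    ring
  have h2 : Tendsto (fun t : ℝ => (‖resolvent L (-1)‖ ^ 2 * ‖v‖) / t) atTop (𝓝 0) :=
    tendsto_const_nhds.div_atTop tendsto_id
  have h3 := ge_of_tendsto h2 ((eventually_gt_atTop 0).mono h)
  exact (sub_eq_zero.mp (norm_le_zero_iff.mp h3)).symm

/-- The rescaled semigroup tends to zero on the orthogonal complement of the eigenspace to the
bottom of the spectrum. That complement is the closure of the range of `‖R‖ - R`, where
`R = (L + 1)⁻¹`. -/
theorem tendsto_heatSemigroup_zero [Nontrivial H] (hsa : IsSelfAdjoint L)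
    (hpos : IsNonnegative L) {f : H}
    (hf : ∀ v : H, resolvent L (-1) v = (‖resolvent L (-1)‖ : ℂ) • v → inner ℂ v f = 0) :
    Tendsto (fun t : ℝ => (Real.exp (t * bottom L) : ℂ) • heatSemigroup L t f) atTop (𝓝 0) := by
  have hR := resolvent_isSelfAdjoint hsa hpos
  set r₀ := ‖resolvent L (-1)‖ with hr0
  set B : H →L[ℂ] H := algebraMap ℝ _ r₀ - resolvent L (-1) with hB
  have hBsa : IsSelfAdjoint B := (IsSelfAdjoint.algebraMap _ (by rfl)).sub hR
  have hBf : ∀ g, B g = (r₀ : ℂ) • g - resolvent L (-1) g := fun g => rfl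
  have hmem : f ∈ closure (Set.range B) := by
    have h1 : f ∈ B.kerᗮ := by
      rw [Submodule.mem_orthogonal]
      intro v hv
      have h2 : B v = 0 := hv
      rw [hBf] at h2
      exact hf v (sub_eq_zero.mp h2).symm
    rw [ContinuousLinearMap.orthogonal_ker, hBsa.adjoint_eq] at h1
    exact h1
  -- the contractions `e^{t E₀} e^{-tL}` tend to zero on `range B`, hence on its closure
  rw [Metric.tendsto_atTop]
  intro ε hε
  obtain ⟨_, ⟨g, rfl⟩, hg⟩ := Metric.mem_closure_iff.mp hmem (ε / 2) (half_pos hε)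
  have hlim : Tendsto (fun t : ℝ => (r₀ ^ 2 * ‖g‖) / t) atTop (𝓝 0) :=
    tendsto_const_nhds.div_atTop tendsto_id
  obtain ⟨N, hN⟩ := eventually_atTop.mp (hlim.eventually (gt_mem_nhds (half_pos hε)))
  refine ⟨max N 1, fun t ht => ?_⟩
  have ht0 : 0 < t := lt_of_lt_of_le one_pos ((le_max_right _ _).trans ht)
  have hexp : Real.exp (t * bottom L) * Real.exp (-t * bottom L) = 1 := by
    rw [← Real.exp_add]; simp
  have h3 : ‖(Real.exp (t * bottom L) : ℂ) • heatSemigroup L t (f - B g)‖ < ε / 2 := by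
    rw [norm_smul, Complex.norm_real, Real.norm_of_nonneg (Real.exp_pos _).le]
    calc _ ≤ Real.exp (t * bottom L) * (Real.exp (-t * bottom L) * ‖f - B g‖) := by
          gcongr
          exact norm_heatSemigroup_apply_le hsa hpos ht0 _
      _ = ‖f - B g‖ := by rw [← mul_assoc, hexp, one_mul]
      _ < ε / 2 := by rwa [← dist_eq_norm]
  have h4 : ‖(Real.exp (t * bottom L) : ℂ) • heatSemigroup L t (B g)‖ < ε / 2 := by
    rw [norm_smul, Complex.norm_real, Real.norm_of_nonneg (Real.exp_pos _).le, hBf, map_sub,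
      map_smul, heatSemigroup_resolvent_comm hsa hpos ht0]
    calc _ ≤ Real.exp (t * bottom L) * (r₀ ^ 2 / t * Real.exp (-t * bottom L) * ‖g‖) := by
          gcongr
          exact norm_smul_sub_resolvent_heatSemigroup_le hsa hpos ht0 g
      _ = (r₀ ^ 2 * ‖g‖) / t * (Real.exp (t * bottom L) * Real.exp (-t * bottom L)) := by ring
      _ = (r₀ ^ 2 * ‖g‖) / t := by rw [hexp, mul_one]
      _ < ε / 2 := hN t ((le_max_left _ _).trans ht)
  rw [dist_zero_right]
  calc _ = ‖(Real.exp (t * bottom L) : ℂ) • heatSemigroup L t (f - B g) +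
        (Real.exp (t * bottom L) : ℂ) • heatSemigroup L t (B g)‖ := by
          rw [← smul_add, ← map_add, sub_add_cancel]
    _ ≤ _ := norm_add_le _ _
    _ < ε / 2 + ε / 2 := add_lt_add h3 h4
    _ = ε := add_halves ε

/-- The semigroup maps into the domain of `L`, and `L e^{-tL}` is its derivative, here in the form
of a second order estimate of the left difference quotient. -/
theorem exists_generator_bound [Nontrivial H] (hsa : IsSelfAdjoint L)
    (hpos : IsNonnegative L) {t : ℝ} (ht : 0 < t) (f : H) :
    ∃ h : heatSemigroup L t f ∈ L.domain, ∀ ε : ℝ, 0 < ε → ε ≤ t / 2 →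
      ‖heatSemigroup L (t - ε) f - heatSemigroup L t f - (ε : ℂ) • L ⟨heatSemigroup L t f, h⟩‖ ≤
        8 / t ^ 2 * ε ^ 2 * ‖f‖ := by
  have hR := resolvent_isSelfAdjoint hsa hpos
  set R := resolvent L (-1) with hRdef
  have hc := continuous_inv_mul_heatSymbol ht
  have hc' := continuous_heatSymbol ht
  -- `S` is `(L + 1) e^{-tL}`
  set S := cfc (fun r : ℝ => r⁻¹ * heatSymbol t r) R with hS
  have hRS : heatSemigroup L t = R * S := by
    rw [hS]
    nth_rewrite 1 [← cfc_id' ℝ R hR]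
    rw [← cfc_mul _ _ _ (by fun_prop) hc.continuousOn, heatSemigroup_of_pos ht]
    refine congrArg (fun f => cfc f R) (funext fun r => ?_)
    rcases eq_or_ne r 0 with rfl | hr
    · rw [heatSymbol_of_nonpos _ le_rfl]; simp
    · rw [mul_inv_cancel_left₀ hr]
  have hRSf : heatSemigroup L t f = R (S f) := by rw [hRS]; rfl
  have hd : heatSemigroup L t f ∈ L.domain := by
    rw [hRSf]; exact resolvent_mem_domain hsa hpos _
  have hL : L ⟨heatSemigroup L t f, hd⟩ = S f - heatSemigroup L t f := by
    simp only [hRSf]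
    exact apply_resolvent hsa hpos _ _
  refine ⟨hd, fun ε hε hεt => ?_⟩
  have htε : 0 < t - ε := by linarith
  have hop : cfc (fun r : ℝ => heatSymbol (t - ε) r - heatSymbol t r -
      ε * (r⁻¹ * heatSymbol t r - heatSymbol t r)) R =
      heatSemigroup L (t - ε) - heatSemigroup L t - ε • (S - heatSemigroup L t) := by
    have hc'' := continuous_heatSymbol htε
    have h1 : Continuous fun r => heatSymbol (t - ε) r - heatSymbol t r := hc''.sub hc'
    have h2 : Continuous fun r => r⁻¹ * heatSymbol t r - heatSymbol t r := hc.sub hc'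
    rw [cfc_sub (fun r => heatSymbol (t - ε) r - heatSymbol t r)
        (fun r => ε * (r⁻¹ * heatSymbol t r - heatSymbol t r)) R
        h1.continuousOn (h2.const_mul ε).continuousOn,
      cfc_sub (heatSymbol (t - ε)) (heatSymbol t) R hc''.continuousOn hc'.continuousOn,
      cfc_const_mul ε (fun r => r⁻¹ * heatSymbol t r - heatSymbol t r) R h2.continuousOn,
      cfc_sub (fun r => r⁻¹ * heatSymbol t r) (heatSymbol t) R hc.continuousOn hc'.continuousOn,
      heatSemigroup_of_pos ht, heatSemigroup_of_pos htε]
  have hn : ‖heatSemigroup L (t - ε) - heatSemigroup L t - ε • (S - heatSemigroup L t)‖ ≤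
      8 / t ^ 2 * ε ^ 2 := by
    rw [← hop]
    refine norm_cfc_le (by positivity) fun r hr => ?_
    have h3 := spectrum_resolvent_bounds hsa hpos hr
    have h4 := abs_heatSymbol_sub_le hε hεt h3.1 h3.2.2
    rwa [sub_mul, one_mul] at h4
  rw [hL]
  exact ContinuousLinearMap.le_of_opNorm_le _ hn f

/-- The semigroup is injective: if `e^{-tL} f = 0`, then `e^{-sL} f = 0` for `s = t / 2 ^ n`, and
`e^{-sL} → 1` strongly as `s → 0`. -/
theorem heatSemigroup_apply_ne_zero [Nontrivial H] (hsa : IsSelfAdjoint L)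
    (hpos : IsNonnegative L) {t : ℝ} (ht : 0 < t) {f : H} (hf : f ≠ 0) :
    heatSemigroup L t f ≠ 0 := by
  intro h0
  have hR := resolvent_isSelfAdjoint hsa hpos
  have hhalf : ∀ n : ℕ, heatSemigroup L (t / 2 ^ n) f = 0 := by
    intro n
    induction n with
    | zero => simpa using h0
    | succ n ih =>
      have h1 : 0 < t / 2 ^ (n + 1) := by positivity
      have h2 := inner_heatSemigroup_add_self (L := L) h1 f
      rw [show t / 2 ^ (n + 1) + t / 2 ^ (n + 1) = t / 2 ^ n by field_simp; ring, ih,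
        inner_zero_right] at h2
      simpa using h2.symm
  have hbound : ∀ s : ℝ, 0 < s → heatSemigroup L s f = 0 → ‖resolvent L (-1) f‖ ≤ s * ‖f‖ := by
    intro s hs hsf
    have hop : cfc (fun r : ℝ => (1 - heatSymbol s r) * r) (resolvent L (-1)) =
        (1 - heatSemigroup L s) * resolvent L (-1) := by
      have hc := continuous_heatSymbol hs
      rw [cfc_mul _ _ _ (by fun_prop) (by fun_prop),
        cfc_sub _ _ _ (by fun_prop) hc.continuousOn, cfc_const 1 _,
        cfc_id' ℝ (resolvent L (-1)), heatSemigroup_of_pos hs, map_one]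
    have hn : ‖(1 - heatSemigroup L s) * resolvent L (-1)‖ ≤ s := by
      rw [← hop]
      refine norm_cfc_le hs.le fun r hr => ?_
      have h3 := spectrum_resolvent_bounds hsa hpos hr
      exact abs_heatSymbol_sub_one_mul_le hs h3.1 h3.2.2
    have h4 := ContinuousLinearMap.le_of_opNorm_le _ hn f
    change ‖resolvent L (-1) f - heatSemigroup L s (resolvent L (-1) f)‖ ≤ s * ‖f‖ at h4
    rwa [heatSemigroup_resolvent_comm hsa hpos hs, hsf, map_zero, sub_zero] at h4
  have hlim : Tendsto (fun n : ℕ => t / 2 ^ n * ‖f‖) atTop (𝓝 0) := by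
    have h1 : Tendsto (fun n : ℕ => (2 : ℝ) ^ n) atTop atTop :=
      tendsto_pow_atTop_atTop_of_one_lt one_lt_two
    simpa using (h1.const_div_atTop t).mul_const ‖f‖
  have h5 := ge_of_tendsto' hlim fun n => hbound _ (by positivity) (hhalf n)
  exact hf ((resolvent_eq_zero_iff hsa hpos).mp (norm_le_zero_iff.mp h5))

/-- Exponential decay on a dense set of vectors, with constants that depend on the vector, already
bounds the norm of the semigroup, because `‖e^{-tL} f‖` is logarithmically convex in `t`. -/
theorem norm_heatSemigroup_le_of_dense [Nontrivial H] {E : ℝ} {D : Set H} (hD : Dense D)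
    (h : ∀ f ∈ D, ∃ C : ℝ, ∀ t : ℝ, 0 < t → ‖heatSemigroup L t f‖ ≤ C * Real.exp (-t * E))
    {t : ℝ} (ht : 0 < t) : ‖heatSemigroup L t‖ ≤ Real.exp (-t * E) := by
  have hdense : ∀ f ∈ D, ‖heatSemigroup L t f‖ ≤ Real.exp (-t * E) * ‖f‖ := by
    intro f hf
    rcases eq_or_ne f 0 with rfl | hf0
    · simp
    obtain ⟨C, hC⟩ := h f hf
    have hfn : 0 < ‖f‖ := norm_pos_iff.mpr hf0
    have hsq : ∀ s : ℝ, 0 < s →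
        ‖heatSemigroup L s f‖ ^ 2 ≤ ‖f‖ * ‖heatSemigroup L (s + s) f‖ := by
      intro s hs
      have h1 := norm_inner_le_norm (𝕜 := ℂ) f (heatSemigroup L (s + s) f)
      rw [inner_heatSemigroup_add_self hs] at h1
      simpa using h1
    -- `q s` is the ratio of `‖e^{-sL} f‖` to the asserted bound
    set q : ℝ → ℝ := fun s => ‖heatSemigroup L s f‖ * Real.exp (s * E) / ‖f‖ with hq
    have hq0 : ∀ s, 0 ≤ q s := fun s => by positivity
    have hq2 : ∀ s : ℝ, 0 < s → q s ^ 2 ≤ q (s + s) := by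
      intro s hs
      simp only [hq]
      rw [div_pow, mul_pow, div_le_div_iff₀ (by positivity) hfn, ← Real.exp_nat_mul]
      have : Real.exp ((2 : ℕ) * (s * E)) = Real.exp ((s + s) * E) := by
        congr 1; push_cast; ring
      rw [this]
      have := mul_le_mul_of_nonneg_right (hsq s hs)
        (mul_nonneg (Real.exp_pos ((s + s) * E)).le hfn.le)
      linarith
    have hqpow : ∀ n : ℕ, q t ^ 2 ^ n ≤ q (2 ^ n * t) := by
      intro n
      induction n with
      | zero => simp
      | succ n ih =>
        calc q t ^ 2 ^ (n + 1) = (q t ^ 2 ^ n) ^ 2 := by rw [pow_succ, pow_mul]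
          _ ≤ q (2 ^ n * t) ^ 2 := by gcongr
          _ ≤ q (2 ^ n * t + 2 ^ n * t) := hq2 _ (by positivity)
          _ = q (2 ^ (n + 1) * t) := by congr 1; ring
    have hqb : ∀ s : ℝ, 0 < s → q s ≤ C / ‖f‖ := by
      intro s hs
      simp only [hq]
      gcongr
      calc _ ≤ C * Real.exp (-s * E) * Real.exp (s * E) := by gcongr; exact hC s hs
        _ = C := by rw [mul_assoc, ← Real.exp_add]; simp
    have hq1 : q t ≤ 1 := by
      by_contra! hlt
      have h1 := (tendsto_pow_atTop_atTop_of_one_lt hlt).comp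
        (tendsto_pow_atTop_atTop_of_one_lt (one_lt_two (α := ℕ)))
      obtain ⟨n, hn⟩ := (h1.eventually (eventually_gt_atTop (C / ‖f‖))).exists
      exact absurd ((hqpow n).trans (hqb _ (by positivity))) (not_le.mpr hn)
    simp only [hq] at hq1
    rw [div_le_one hfn] at hq1
    calc ‖heatSemigroup L t f‖
        = Real.exp (-t * E) * (‖heatSemigroup L t f‖ * Real.exp (t * E)) := by
          rw [mul_left_comm, ← Real.exp_add]; simp
      _ ≤ _ := by gcongr
  refine ContinuousLinearMap.opNorm_le_bound _ (Real.exp_pos _).le fun f => ?_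
  refine hD.induction (P := fun f => ‖heatSemigroup L t f‖ ≤ Real.exp (-t * E) * ‖f‖) hdense ?_ f
  exact isClosed_le (by fun_prop) (by fun_prop)

end UnboundedOp

/-! ### Pointwise description of `ℓ²(V, m)` -/

section WeightedL2

variable {V : Type*} [MeasurableSpace V] [DiscreteMeasurableSpace V] {m : V → ℝ}

/-- All points have positive mass, so the elements of `ℓ²(V, m)` are honest functions. -/
theorem ae_discreteMeasure_iff (hm : ∀ x, 0 < m x) {p : V → Prop} :
    (∀ᵐ x ∂discreteMeasure m, p x) ↔ ∀ x, p x := by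
  refine ⟨fun h x => ?_, fun h => Eventually.of_forall h⟩
  by_contra hx
  have h1 : discreteMeasure m {x} ≤ discreteMeasure m {y | ¬ p y} :=
    measure_mono (Set.singleton_subset_iff.mpr hx)
  rw [ae_iff.mp h, discreteMeasure_singleton, nonpos_iff_eq_zero, ENNReal.ofReal_eq_zero] at h1
  exact absurd (hm x) h1.not_gt

namespace WeightedL2

theorem ext_apply (hm : ∀ x, 0 < m x) {f g : WeightedL2 m}
    (h : ∀ x, (f : V → ℂ) x = (g : V → ℂ) x) : f = g :=
  Lp.ext ((ae_discreteMeasure_iff hm).mpr h)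

theorem zero_apply (hm : ∀ x, 0 < m x) (x : V) : ((0 : WeightedL2 m) : V → ℂ) x = 0 :=
  (ae_discreteMeasure_iff hm).mp (Lp.coeFn_zero ℂ 2 (discreteMeasure m)) x

theorem sub_apply (hm : ∀ x, 0 < m x) (f g : WeightedL2 m) (x : V) :
    ((f - g : WeightedL2 m) : V → ℂ) x = (f : V → ℂ) x - (g : V → ℂ) x :=
  (ae_discreteMeasure_iff hm).mp (Lp.coeFn_sub f g) x

theorem smul_apply (hm : ∀ x, 0 < m x) (c : ℂ) (f : WeightedL2 m) (x : V) :
    ((c • f : WeightedL2 m) : V → ℂ) x = c * (f : V → ℂ) x :=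
  (ae_discreteMeasure_iff hm).mp (Lp.coeFn_smul c f) x

theorem pointFunction_apply (hm : ∀ x, 0 < m x) (x y : V) :
    (pointFunction m y : V → ℂ) x = ({y} : Set V).indicator (fun _ => (1 : ℂ)) x :=
  (ae_discreteMeasure_iff hm).mp indicatorConstLp_coeFn x

theorem pointFunction_apply_self (hm : ∀ x, 0 < m x) (x : V) :
    (pointFunction m x : V → ℂ) x = 1 := by
  rw [pointFunction_apply hm, Set.indicator_of_mem (Set.mem_singleton x)]

theorem pointFunction_nonneg (hm : ∀ x, 0 < m x) (y x : V) :
    0 ≤ ((pointFunction m y : V → ℂ) x).re ∧ ((pointFunction m y : V → ℂ) x).im = 0 := by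
  rw [pointFunction_apply hm]
  rcases Set.indicator_eq_zero_or_self {y} (fun _ => (1 : ℂ)) x with h | h <;> rw [h] <;> simp

theorem pointFunction_ne_zero (hm : ∀ x, 0 < m x) (x : V) : pointFunction m x ≠ 0 := by
  intro h
  have := pointFunction_apply_self hm x
  rw [h, zero_apply hm] at this
  exact zero_ne_one this

theorem nontrivial [Nonempty V] (hm : ∀ x, 0 < m x) : Nontrivial (WeightedL2 m) :=
  ⟨_, 0, pointFunction_ne_zero hm (Classical.arbitrary V)⟩

theorem hasSum_inner (hm : ∀ x, 0 < m x) (f g : WeightedL2 m) :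
    HasSum (fun x => (m x : ℂ) * inner ℂ ((f : V → ℂ) x) ((g : V → ℂ) x)) (inner ℂ f g) := by
  have hint : Integrable (fun y => inner ℂ ((f : V → ℂ) y) ((g : V → ℂ) y))
      (Measure.sum fun x => ENNReal.ofReal (m x) • Measure.dirac x) :=
    L2.integrable_inner (𝕜 := ℂ) f g
  have h1 := hasSum_integral_measure hint
  have h2 : (∫ y, inner ℂ ((f : V → ℂ) y) ((g : V → ℂ) y)
      ∂(Measure.sum fun x => ENNReal.ofReal (m x) • Measure.dirac x)) = inner ℂ f g :=
    (L2.inner_def f g).symm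
  rw [h2] at h1
  refine (congrArg (HasSum · (inner ℂ f g)) (funext fun y => ?_)).mp h1
  rw [integral_smul_measure, integral_dirac, ENNReal.toReal_ofReal (hm y).le]
  simp

theorem dense_span_pointFunction (hm : ∀ x, 0 < m x) :
    Dense (Submodule.span ℂ (Set.range (pointFunction m)) : Set (WeightedL2 m)) := by
  rw [Submodule.dense_iff_topologicalClosure_eq_top, Submodule.topologicalClosure_eq_top_iff,
    Submodule.eq_bot_iff]
  intro f hf
  refine ext_apply hm fun x => ?_
  have h := (Submodule.mem_orthogonal _ _).mp hf (pointFunction m x)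
    (Submodule.subset_span (Set.mem_range_self x))
  rw [inner_pointFunction hm] at h
  rw [zero_apply hm]
  exact (mul_eq_zero.mp h).resolve_left (by exact_mod_cast (hm x).ne')

/-- The pointwise modulus of a square summable function. -/
theorem exists_modulus (hm : ∀ x, 0 < m x) (f : WeightedL2 m) :
    ∃ g : WeightedL2 m, ∀ x, (g : V → ℂ) x = (‖(f : V → ℂ) x‖ : ℂ) := by
  have h : MemLp (fun x => (‖(f : V → ℂ) x‖ : ℂ)) 2 (discreteMeasure m) :=
    (Lp.memLp f).norm.ofReal
  exact ⟨h.toLp, (ae_discreteMeasure_iff hm).mp h.coeFn_toLp⟩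

end WeightedL2

end WeightedL2

/-! ### Strict positivity of the heat kernel -/

section HeatKernel

open UnboundedOp WeightedL2

variable {V : Type*} [MeasurableSpace V] [DiscreteMeasurableSpace V]
  {m : V → ℝ} {L : WeightedL2 m →ₗ.[ℂ] WeightedL2 m}

theorem heatSemigroup_pointFunction_apply (hm : ∀ x, 0 < m x) (t : ℝ) (x y : V) :
    (heatSemigroup L t (pointFunction m y) : V → ℂ) x = heatKernel L t x y * m y := by
  have hy : (m y : ℂ) ≠ 0 := by exact_mod_cast (hm y).ne'
  rw [heatKernel, operatorKernel, div_mul_cancel₀ _ hy]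

theorem heatKernel_nonneg (hm : ∀ x, 0 < m x)
    (hpp : ∀ t : ℝ, 0 < t → IsPositivityPreserving (heatSemigroup L t)) {t : ℝ} (ht : 0 < t)
    (x y : V) : 0 ≤ (heatKernel L t x y).re ∧ (heatKernel L t x y).im = 0 := by
  have h := hpp t ht _ (pointFunction_nonneg hm y) x
  rw [heatKernel, operatorKernel, Complex.div_ofReal_re, Complex.div_ofReal_im, h.2, zero_div]
  exact ⟨div_nonneg h.1 (hm y).le, rfl⟩

/-- At a zero of `x ↦ p_t(x, y)` the time derivative `-L̃ p_t(·, y)(x)` is non-positive, as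
`s ↦ p_s(x, y)` is non-negative for `s < t`. -/
theorem heatKernel_eq_zero_of_adj (hm : ∀ x, 0 < m x) {G : WeightedGraph V}
    (hsa : IsSelfAdjoint L) (hpos : IsNonnegative L) (hL : IsRestrictionOfFormalLaplacian G m L)
    (hpp : ∀ t : ℝ, 0 < t → IsPositivityPreserving (heatSemigroup L t)) {t : ℝ} (ht : 0 < t)
    {x y z : V} (hxz : 0 < G.b x z) (hx : heatKernel L t x y = 0) : heatKernel L t z y = 0 := by
  have : Nonempty V := ⟨x⟩
  have : Nontrivial (WeightedL2 m) := WeightedL2.nontrivial hm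
  obtain ⟨hd, hb⟩ := exists_generator_bound hsa hpos ht (pointFunction m y)
  have hu0 : ∀ s : ℝ, 0 < s → ∀ w, 0 ≤ ((heatSemigroup L s (pointFunction m y) : V → ℂ) w).re ∧
      ((heatSemigroup L s (pointFunction m y) : V → ℂ) w).im = 0 :=
    fun s hs => hpp s hs _ (pointFunction_nonneg hm y)
  have hux : (heatSemigroup L t (pointFunction m y) : V → ℂ) x = 0 := by
    rw [heatSemigroup_pointFunction_apply hm, hx, zero_mul]
  set u := heatSemigroup L t (pointFunction m y) with hu
  set v := L ⟨u, hd⟩ with hv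
  -- the difference quotient from the left
  have hvx : 0 ≤ ((v : V → ℂ) x).re := by
    set K := ‖pointFunction m x‖ * (8 / t ^ 2 * ‖pointFunction m y‖) with hK
    have h1 : ∀ ε : ℝ, 0 < ε → ε ≤ t / 2 → -(m x * ((v : V → ℂ) x).re) ≤ K * ε := by
      intro ε hε hεt
      have h2 := (Complex.re_le_norm _).trans ((norm_inner_le_norm (𝕜 := ℂ) (pointFunction m x)
        (heatSemigroup L (t - ε) (pointFunction m y) - u - (ε : ℂ) • v)).trans
        (mul_le_mul_of_nonneg_left (hb ε hε hεt) (norm_nonneg _)))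
      rw [inner_pointFunction hm, WeightedL2.sub_apply hm, WeightedL2.sub_apply hm,
        WeightedL2.smul_apply hm, hux, sub_zero, Complex.re_ofReal_mul, Complex.sub_re,
        Complex.re_ofReal_mul] at h2
      have h3 := mul_nonneg (hm x).le (hu0 (t - ε) (by linarith) x).1
      refine le_of_mul_le_mul_left (a := ε) ?_ hε
      rw [hK]
      linarith
    have h4 : Tendsto (fun ε : ℝ => K * ε) (𝓝[>] 0) (𝓝 0) := by
      have : Tendsto (fun ε : ℝ => K * ε) (𝓝 0) (𝓝 (K * 0)) := tendsto_id.const_mul K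
      rw [mul_zero] at this
      exact this.mono_left nhdsWithin_le_nhds
    have h5 : -(m x * ((v : V → ℂ) x).re) ≤ 0 := by
      refine ge_of_tendsto h4 ?_
      filter_upwards [Ioc_mem_nhdsGT (half_pos ht)] with ε hε using h1 ε hε.1 hε.2
    exact nonneg_of_mul_nonneg_right (by linarith : 0 ≤ m x * ((v : V → ℂ) x).re) (hm x)
  obtain ⟨hdom, hform⟩ := hL ⟨u, hd⟩
  have hs : Summable fun w => (G.b x w : ℂ) * (u : V → ℂ) w := (hdom x).of_norm
  have hterm : ∀ w, ((G.b x w : ℂ) * (u : V → ℂ) w).re = G.b x w * ((u : V → ℂ) w).re :=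
    fun w => Complex.re_ofReal_mul _ _
  have hsre : HasSum (fun w => G.b x w * ((u : V → ℂ) w).re)
      (∑' w, (G.b x w : ℂ) * (u : V → ℂ) w).re := by
    have := Complex.hasSum_re hs.hasSum
    simpa only [hterm] using this
  have hval : ((v : V → ℂ) x).re = -((∑' w, (G.b x w : ℂ) * (u : V → ℂ) w).re / m x) := by
    have h6 := hform x
    rw [WeightedGraph.formalLaplacian] at h6
    simp only [hux, zero_sub, mul_neg, tsum_neg, mul_zero, add_zero] at h6
    change (v : V → ℂ) x = _ at h6
    rw [h6, Complex.neg_re, one_div, ← Complex.ofReal_inv, Complex.re_ofReal_mul]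
    ring
  have hle : (∑' w, (G.b x w : ℂ) * (u : V → ℂ) w).re ≤ 0 := by
    rw [hval] at hvx
    by_contra! hlt
    have := div_pos hlt (hm x)
    linarith
  have hz : G.b x z * ((u : V → ℂ) z).re ≤ 0 :=
    (le_hasSum hsre z fun w _ => mul_nonneg (G.b_nonneg x w) (hu0 t ht w).1).trans hle
  have huz : (u : V → ℂ) z = 0 := by
    apply Complex.ext
    · exact le_antisymm (nonpos_of_mul_nonpos_right hz hxz) (hu0 t ht z).1
    · exact (hu0 t ht z).2
  rw [hu, heatSemigroup_pointFunction_apply hm] at huz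
  exact (mul_eq_zero.mp huz).resolve_right (by exact_mod_cast (hm y).ne')

theorem heatKernel_diag (hm : ∀ x, 0 < m x) {t : ℝ} (ht : 0 < t) (x : V) :
    (m x : ℂ) ^ 2 * heatKernel L (t + t) x x =
      ((‖heatSemigroup L t (pointFunction m x)‖ ^ 2 : ℝ) : ℂ) := by
  have h := inner_heatSemigroup_add_self (L := L) ht (pointFunction m x)
  rw [inner_pointFunction hm, heatSemigroup_pointFunction_apply hm] at h
  rw [Complex.ofReal_pow, ← h]
  ring

theorem heatKernel_diag_re (hm : ∀ x, 0 < m x) {t : ℝ} (ht : 0 < t) (x : V) :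
    m x ^ 2 * (heatKernel L (t + t) x x).re = ‖heatSemigroup L t (pointFunction m x)‖ ^ 2 := by
  have h := congrArg Complex.re (heatKernel_diag (L := L) hm ht x)
  rwa [← Complex.ofReal_pow, Complex.re_ofReal_mul, Complex.ofReal_re] at h

theorem heatKernel_pos (hm : ∀ x, 0 < m x) {G : WeightedGraph V} (hG : G.IsConnected)
    (hsa : IsSelfAdjoint L) (hpos : IsNonnegative L) (hL : IsRestrictionOfFormalLaplacian G m L)
    (hpp : ∀ t : ℝ, 0 < t → IsPositivityPreserving (heatSemigroup L t)) {t : ℝ} (ht : 0 < t)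
    (x y : V) : 0 < (heatKernel L t x y).re ∧ (heatKernel L t x y).im = 0 := by
  have : Nonempty V := ⟨x⟩
  have : Nontrivial (WeightedL2 m) := WeightedL2.nontrivial hm
  obtain ⟨h1, h2⟩ := heatKernel_nonneg hm hpp ht x y
  refine ⟨lt_of_le_of_ne h1 fun h3 => ?_, h2⟩
  have hx : heatKernel L t x y = 0 := Complex.ext h3.symm h2
  have hzero : ∀ w, Relation.ReflTransGen (fun u v => 0 < G.b u v) x w →
      heatKernel L t w y = 0 := by
    intro w hw
    induction hw with
    | refl => exact hx
    | tail _ hab ih => exact heatKernel_eq_zero_of_adj hm hsa hpos hL hpp ht hab ih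
  have hy := hzero y (hG x y)
  have h4 := heatKernel_diag_re (L := L) hm (half_pos ht) y
  rw [add_halves, hy, Complex.zero_re, mul_zero] at h4
  exact heatSemigroup_apply_ne_zero hsa hpos (half_pos ht) (pointFunction_ne_zero hm y)
    (norm_eq_zero.mp (pow_eq_zero_iff two_ne_zero |>.mp h4.symm))

theorem hasSum_heatSemigroup_apply [Countable V] (hm : ∀ x, 0 < m x) (t : ℝ) (f : WeightedL2 m)
    (x : V) : HasSum (fun y => heatKernel L t x y * (f : V → ℂ) y * (m y : ℂ))
      ((heatSemigroup L t f : V → ℂ) x) :=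
  hasSum_operatorKernel hm _ f x

/-- One term of the Chapman–Kolmogorov sum. -/
theorem heatKernel_mul_le [Countable V] (hm : ∀ x, 0 < m x)
    (hpp : ∀ t : ℝ, 0 < t → IsPositivityPreserving (heatSemigroup L t)) {s t : ℝ} (hs : 0 < s)
    (ht : 0 < t) (x y z : V) :
    (heatKernel L s x z).re * (heatKernel L t z y).re * m z ≤ (heatKernel L (s + t) x y).re := by
  have h := Complex.hasSum_re (hasSum_heatSemigroup_apply (L := L) hm s
    (heatSemigroup L t (pointFunction m y)) x)
  rw [← heatSemigroup_add_apply hs ht, heatSemigroup_pointFunction_apply hm,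
    Complex.re_mul_ofReal] at h
  have hterm : ∀ w, (heatKernel L s x w *
      (heatSemigroup L t (pointFunction m y) : V → ℂ) w * (m w : ℂ)).re =
      (heatKernel L s x w).re * (heatKernel L t w y).re * m w * m y := by
    intro w
    rw [heatSemigroup_pointFunction_apply hm, Complex.re_mul_ofReal, Complex.mul_re,
      Complex.re_mul_ofReal, (heatKernel_nonneg hm hpp hs x w).2, zero_mul, sub_zero]
    ring
  simp only [hterm] at h
  have h1 := le_hasSum h z fun w _ => by
    have h2 := (heatKernel_nonneg hm hpp hs x w).1
    have h3 := (heatKernel_nonneg hm hpp ht w y).1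
    have h4 := (hm w).le
    have h5 := (hm y).le
    positivity
  exact le_of_mul_le_mul_right h1 (hm y)

/-! ### The ground state -/

theorem norm_heatSemigroup_apply_le_modulus [Countable V] (hm : ∀ x, 0 < m x)
    (hpp : ∀ t : ℝ, 0 < t → IsPositivityPreserving (heatSemigroup L t)) {t : ℝ} (ht : 0 < t)
    {f g : WeightedL2 m} (hg : ∀ x, (g : V → ℂ) x = (‖(f : V → ℂ) x‖ : ℂ)) (x : V) :
    ‖(heatSemigroup L t f : V → ℂ) x‖ ≤ ((heatSemigroup L t g : V → ℂ) x).re := by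
  refine (hasSum_heatSemigroup_apply hm t f x).norm_le_of_bounded
    (Complex.hasSum_re (hasSum_heatSemigroup_apply hm t g x)) fun y => ?_
  obtain ⟨h1, h2⟩ := heatKernel_nonneg hm hpp ht x y
  have h3 : heatKernel L t x y = ((heatKernel L t x y).re : ℂ) := Complex.ext rfl h2
  rw [h3, hg, ← Complex.ofReal_mul, ← Complex.ofReal_mul, Complex.ofReal_re, norm_mul, norm_mul,
    Complex.norm_real, Complex.norm_real, Real.norm_of_nonneg h1, Real.norm_of_nonneg (hm y).le]

/-- The modulus of an eigenfunction to the bottom of the spectrum is again an eigenfunction: with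
`w = |f|` and `c = ‖e^{-tL}‖`, positivity gives `c w ≤ e^{-tL} w` pointwise, while
`‖e^{-tL} w‖ ≤ c ‖w‖`. -/
theorem resolvent_modulus [Countable V] [Nonempty V] (hm : ∀ x, 0 < m x)
    (hsa : IsSelfAdjoint L) (hpos : IsNonnegative L)
    (hpp : ∀ t : ℝ, 0 < t → IsPositivityPreserving (heatSemigroup L t))
    {f w : WeightedL2 m}
    (hf : UnboundedOp.resolvent L (-1) f = (‖UnboundedOp.resolvent L (-1)‖ : ℂ) • f)
    (hw : ∀ x, (w : V → ℂ) x = (‖(f : V → ℂ) x‖ : ℂ)) :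
    UnboundedOp.resolvent L (-1) w = (‖UnboundedOp.resolvent L (-1)‖ : ℂ) • w := by
  have : Nontrivial (WeightedL2 m) := WeightedL2.nontrivial hm
  refine resolvent_apply_of_forall_heatSemigroup hsa hpos fun t ht => ?_
  set c := Real.exp (-t * bottom L) with hc
  have hc0 : 0 < c := Real.exp_pos _
  have hpt : ∀ x, c * ‖(f : V → ℂ) x‖ ≤ ((heatSemigroup L t w : V → ℂ) x).re := by
    intro x
    have h1 := norm_heatSemigroup_apply_le_modulus hm hpp ht hw x
    rwa [heatSemigroup_apply_of_eigenvector hsa hpos ht hf, WeightedL2.smul_apply hm, norm_mul,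
      Complex.norm_real, Real.norm_of_nonneg hc0.le] at h1
  have hinner : c * ‖w‖ ^ 2 ≤ (inner ℂ (heatSemigroup L t w) w).re := by
    have h1 := (Complex.hasSum_re (hasSum_inner hm w w)).mul_left c
    have h2 := Complex.hasSum_re (hasSum_inner hm (heatSemigroup L t w) w)
    have h3 : (inner ℂ w w).re = ‖w‖ ^ 2 := inner_self_eq_norm_sq (𝕜 := ℂ) w
    rw [h3] at h1
    refine hasSum_le (fun x => ?_) h1 h2
    rw [hw, RCLike.inner_apply, RCLike.inner_apply, Complex.re_ofReal_mul, Complex.re_ofReal_mul]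
    simp only [Complex.conj_ofReal, Complex.re_ofReal_mul, Complex.ofReal_re, Complex.conj_re]
    have h4 := mul_le_mul_of_nonneg_left (hpt x)
      (mul_nonneg (hm x).le (norm_nonneg ((f : V → ℂ) x)))
    linarith
  have hnorm : ‖heatSemigroup L t w - (c : ℂ) • w‖ ^ 2 ≤ 0 := by
    rw [norm_sub_sq (𝕜 := ℂ), inner_smul_right, norm_smul, Complex.norm_real,
      Real.norm_of_nonneg hc0.le]
    have h1 := norm_heatSemigroup_apply_le hsa hpos ht w
    have h2 : ‖heatSemigroup L t w‖ ^ 2 ≤ (c * ‖w‖) ^ 2 := by gcongr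
    have h3 : RCLike.re ((c : ℂ) * inner ℂ (heatSemigroup L t w) w) =
        c * (inner ℂ (heatSemigroup L t w) w).re := Complex.re_ofReal_mul _ _
    have h4 := mul_le_mul_of_nonneg_left hinner hc0.le
    rw [h3]
    linarith
  have h5 := pow_eq_zero_iff two_ne_zero |>.mp (le_antisymm hnorm (sq_nonneg _))
  exact sub_eq_zero.mp (norm_eq_zero.mp h5)

theorem eigenfunction_apply_ne_zero [Countable V] [Nonempty V] (hm : ∀ x, 0 < m x)
    {G : WeightedGraph V} (hG : G.IsConnected) (hsa : IsSelfAdjoint L) (hpos : IsNonnegative L)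
    (hL : IsRestrictionOfFormalLaplacian G m L)
    (hpp : ∀ t : ℝ, 0 < t → IsPositivityPreserving (heatSemigroup L t))
    {f : WeightedL2 m}
    (hf : UnboundedOp.resolvent L (-1) f = (‖UnboundedOp.resolvent L (-1)‖ : ℂ) • f)
    (hf0 : f ≠ 0) (x : V) : (f : V → ℂ) x ≠ 0 := by
  have : Nontrivial (WeightedL2 m) := WeightedL2.nontrivial hm
  obtain ⟨w, hw⟩ := exists_modulus hm f
  have hwe := resolvent_modulus hm hsa hpos hpp hf hw
  obtain ⟨z, hz⟩ : ∃ z, (f : V → ℂ) z ≠ 0 := by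
    by_contra! h
    exact hf0 (ext_apply hm fun z => by rw [h, zero_apply hm])
  intro hx
  have h1 := Complex.hasSum_re (hasSum_heatSemigroup_apply (L := L) hm 1 w x)
  rw [heatSemigroup_apply_of_eigenvector hsa hpos one_pos hwe, WeightedL2.smul_apply hm, hw x, hx,
    norm_zero, Complex.ofReal_zero, mul_zero, Complex.zero_re] at h1
  have hterm : ∀ y, (heatKernel L 1 x y * (w : V → ℂ) y * (m y : ℂ)).re =
      (heatKernel L 1 x y).re * ‖(f : V → ℂ) y‖ * m y := by
    intro y
    rw [hw, Complex.re_mul_ofReal, Complex.re_mul_ofReal]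
  simp only [hterm] at h1
  have h2 := le_hasSum h1 z fun y _ =>
    mul_nonneg (mul_nonneg (heatKernel_nonneg hm hpp one_pos x y).1 (norm_nonneg _)) (hm y).le
  have h3 := mul_pos (mul_pos (heatKernel_pos hm hG hsa hpos hL hpp one_pos x z).1
    (norm_pos_iff.mpr hz)) (hm z)
  linarith

/-- The eigenspace to the bottom of the spectrum is at most one-dimensional, since the evaluation
at a point is injective on it. -/
theorem exists_eq_smul_of_eigenfunction [Countable V] [Nonempty V] (hm : ∀ x, 0 < m x)
    {G : WeightedGraph V} (hG : G.IsConnected) (hsa : IsSelfAdjoint L) (hpos : IsNonnegative L)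
    (hL : IsRestrictionOfFormalLaplacian G m L)
    (hpp : ∀ t : ℝ, 0 < t → IsPositivityPreserving (heatSemigroup L t))
    {f g : WeightedL2 m}
    (hf : UnboundedOp.resolvent L (-1) f = (‖UnboundedOp.resolvent L (-1)‖ : ℂ) • f)
    (hg : UnboundedOp.resolvent L (-1) g = (‖UnboundedOp.resolvent L (-1)‖ : ℂ) • g) (hg0 : g ≠ 0) :
    ∃ c : ℂ, f = c • g := by
  set x := Classical.arbitrary V
  have hgx := eigenfunction_apply_ne_zero hm hG hsa hpos hL hpp hg hg0 x
  refine ⟨(f : V → ℂ) x / (g : V → ℂ) x, sub_eq_zero.mp ?_⟩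
  by_contra h
  refine eigenfunction_apply_ne_zero hm hG hsa hpos hL hpp ?_ h x ?_
  · rw [map_sub, map_smul, hf, hg, smul_sub, smul_comm]
  · rw [WeightedL2.sub_apply hm, WeightedL2.smul_apply hm, div_mul_cancel₀ _ hgx, sub_self]

/-- If the bottom of the spectrum is an eigenvalue, then it has a strictly positive normalized
eigenfunction. -/
theorem exists_pos_eigenfunction [Countable V] [Nonempty V] (hm : ∀ x, 0 < m x)
    {G : WeightedGraph V} (hG : G.IsConnected) (hsa : IsSelfAdjoint L) (hpos : IsNonnegative L)
    (hL : IsRestrictionOfFormalLaplacian G m L)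
    (hpp : ∀ t : ℝ, 0 < t → IsPositivityPreserving (heatSemigroup L t))
    {f : WeightedL2 m}
    (hf : UnboundedOp.resolvent L (-1) f = (‖UnboundedOp.resolvent L (-1)‖ : ℂ) • f)
    (hf0 : f ≠ 0) :
    ∃ (φ : WeightedL2 m) (Φ : V → ℝ),
      UnboundedOp.resolvent L (-1) φ = (‖UnboundedOp.resolvent L (-1)‖ : ℂ) • φ ∧ ‖φ‖ = 1 ∧
      (∀ x, (φ : V → ℂ) x = Φ x) ∧ ∀ x, 0 < Φ x := by
  obtain ⟨w, hw⟩ := exists_modulus hm f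
  have hwe := resolvent_modulus hm hsa hpos hpp hf hw
  have hpt := eigenfunction_apply_ne_zero hm hG hsa hpos hL hpp hf hf0
  have hw0 : w ≠ 0 := by
    rintro rfl
    have h := hw (Classical.arbitrary V)
    rw [zero_apply hm] at h
    exact hpt _ (norm_eq_zero.mp (by exact_mod_cast h.symm))
  have hwn : 0 < ‖w‖ := norm_pos_iff.mpr hw0
  refine ⟨(‖w‖⁻¹ : ℂ) • w, fun x => ‖w‖⁻¹ * ‖(f : V → ℂ) x‖, ?_, ?_, fun x => ?_, fun x => ?_⟩
  · rw [map_smul, hwe, smul_comm]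
  · rw [norm_smul, norm_inv, Complex.norm_real, norm_norm, inv_mul_cancel₀ hwn.ne']
  · rw [WeightedL2.smul_apply hm, hw, Complex.ofReal_mul, Complex.ofReal_inv]
  · exact mul_pos (inv_pos.mpr hwn) (norm_pos_iff.mpr (hpt x))

/-! ### Large time behaviour -/

/-- Passage from strong convergence of the rescaled semigroup to convergence of its kernel. -/
theorem tendsto_heatKernel_of_tendsto (hm : ∀ x, 0 < m x) {y : V} {g : WeightedL2 m}
    (h : Tendsto
      (fun t : ℝ => (Real.exp (t * bottom L) : ℂ) • heatSemigroup L t (pointFunction m y))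
      atTop (𝓝 g)) (x : V) :
    Tendsto (fun t : ℝ => (Real.exp (t * bottom L) : ℂ) * heatKernel L t x y) atTop
      (𝓝 ((g : V → ℂ) x / m y)) := by
  have hx : (m x : ℂ) ≠ 0 := by exact_mod_cast (hm x).ne'
  have hy : (m y : ℂ) ≠ 0 := by exact_mod_cast (hm y).ne'
  have h1 : Tendsto (fun t : ℝ => inner ℂ (pointFunction m x)
      ((Real.exp (t * bottom L) : ℂ) • heatSemigroup L t (pointFunction m y))) atTop
      (𝓝 (inner ℂ (pointFunction m x) g)) := tendsto_const_nhds.inner h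
  have h2 := (h1.const_mul (m x : ℂ)⁻¹).div_const (m y : ℂ)
  simp only [inner_pointFunction hm, inv_mul_cancel_left₀ hx, WeightedL2.smul_apply hm,
    heatSemigroup_pointFunction_apply hm] at h2
  refine h2.congr fun t => ?_
  rw [← mul_assoc, mul_div_cancel_right₀ _ hy]

theorem tendsto_heatKernel_zero [Nonempty V] (hm : ∀ x, 0 < m x)
    (hsa : IsSelfAdjoint L) (hpos : IsNonnegative L)
    (h0 : ∀ v : WeightedL2 m,
      UnboundedOp.resolvent L (-1) v = (‖UnboundedOp.resolvent L (-1)‖ : ℂ) • v → v = 0) (x y : V) :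
    Tendsto (fun t : ℝ => (Real.exp (t * bottom L) : ℂ) * heatKernel L t x y) atTop (𝓝 0) := by
  have : Nontrivial (WeightedL2 m) := WeightedL2.nontrivial hm
  have h := tendsto_heatKernel_of_tendsto hm (tendsto_heatSemigroup_zero hsa hpos
    (f := pointFunction m y) fun v hv => by rw [h0 v hv, inner_zero_left]) x
  rwa [zero_apply hm, zero_div] at h

theorem tendsto_heatKernel_ground_state [Nonempty V] (hm : ∀ x, 0 < m x)
    (hsa : IsSelfAdjoint L) (hpos : IsNonnegative L) {φ : WeightedL2 m} {Φ : V → ℝ}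
    (hφ : UnboundedOp.resolvent L (-1) φ = (‖UnboundedOp.resolvent L (-1)‖ : ℂ) • φ)
    (hn : ‖φ‖ = 1) (hΦ : ∀ x, (φ : V → ℂ) x = Φ x)
    (hone : ∀ v : WeightedL2 m, UnboundedOp.resolvent L (-1) v =
      (‖UnboundedOp.resolvent L (-1)‖ : ℂ) • v → ∃ c : ℂ, v = c • φ) (x y : V) :
    Tendsto (fun t : ℝ => (Real.exp (t * bottom L) : ℂ) * heatKernel L t x y) atTop
      (𝓝 ((Φ x : ℂ) * (Φ y : ℂ))) := by
  have : Nontrivial (WeightedL2 m) := WeightedL2.nontrivial hm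
  have hy : (m y : ℂ) ≠ 0 := by exact_mod_cast (hm y).ne'
  have hφφ : inner ℂ φ φ = (1 : ℂ) := by
    rw [inner_self_eq_norm_sq_to_K, hn]; simp
  set a : ℂ := inner ℂ φ (pointFunction m y) with ha
  have haval : a = m y * Φ y := by
    rw [ha, ← inner_conj_symm, inner_pointFunction hm, hΦ, map_mul, Complex.conj_ofReal,
      Complex.conj_ofReal]
  have h1 := tendsto_heatSemigroup_zero hsa hpos (f := pointFunction m y - a • φ) fun v hv => by
    obtain ⟨c, rfl⟩ := hone v hv
    rw [inner_smul_left, inner_sub_right, inner_smul_right, hφφ, mul_one, ← ha, sub_self, mul_zero]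
  have h2 : Tendsto (fun t : ℝ => (Real.exp (t * bottom L) : ℂ) •
      heatSemigroup L t (pointFunction m y)) atTop (𝓝 (a • φ)) := by
    have h3 := h1.add_const (a • φ)
    rw [zero_add] at h3
    refine h3.congr' ?_
    filter_upwards [eventually_gt_atTop 0] with t ht
    have hexp : (Real.exp (t * bottom L) : ℂ) * (Real.exp (-t * bottom L) : ℂ) = 1 := by
      rw [← Complex.ofReal_mul, ← Real.exp_add]
      simp
    rw [map_sub, map_smul, heatSemigroup_apply_of_eigenvector hsa hpos ht hφ, smul_sub,
      smul_smul, smul_smul, mul_right_comm, hexp, one_mul, sub_add_cancel]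
  have h3 := tendsto_heatKernel_of_tendsto hm h2 x
  rw [WeightedL2.smul_apply hm, hΦ, haval] at h3
  convert h3 using 2
  field_simp

end HeatKernel

/-! ### The exponential rate -/

/-- A positive function with the exponential upper bound `e^{-tE₀}` and the lower bounds `e^{-tE}`
for all `E > E₀`, up to constants, decays at the rate `E₀`. -/
theorem tendsto_log_div_of_exp_bounds {f : ℝ → ℝ} {E₀ : ℝ} (hf : ∀ t : ℝ, 0 < t → 0 < f t)
    {C : ℝ} (hub : ∀ t : ℝ, 0 < t → f t ≤ C * Real.exp (-t * E₀))
    (hlb : ∀ E : ℝ, E₀ < E → ∃ c : ℝ, 0 < c ∧ ∀ᶠ t : ℝ in atTop, c * Real.exp (-t * E) ≤ f t) :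
    Tendsto (fun t : ℝ => Real.log (f t) / t) atTop (𝓝 (-E₀)) := by
  have hlim : ∀ c : ℝ, Tendsto (fun t : ℝ => Real.log c / t) atTop (𝓝 0) :=
    fun c => tendsto_const_nhds.div_atTop tendsto_id
  have hlog : ∀ c : ℝ, 0 < c → ∀ E t : ℝ, 0 < t →
      Real.log (c * Real.exp (-t * E)) / t = Real.log c / t - E := by
    intro c hc E t ht
    rw [Real.log_mul hc.ne' (Real.exp_pos _).ne', Real.log_exp]
    field_simp
    ring
  rw [tendsto_order]
  constructor
  · intro a ha
    obtain ⟨E, hE, hEa⟩ := exists_between (lt_neg_of_lt_neg ha)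
    obtain ⟨c, hc, hev⟩ := hlb E hE
    filter_upwards [hev, eventually_gt_atTop 0,
      (hlim c).eventually (lt_mem_nhds (by linarith : a + E < 0))] with t h1 ht h2
    calc a < Real.log c / t - E := by linarith
      _ = Real.log (c * Real.exp (-t * E)) / t := (hlog c hc E t ht).symm
      _ ≤ Real.log (f t) / t := by gcongr
  · intro a ha
    have hC : 0 < C := by
      have := (hf 1 one_pos).trans_le (hub 1 one_pos)
      exact pos_of_mul_pos_left this (Real.exp_pos _).le
    filter_upwards [eventually_gt_atTop 0,
      (hlim C).eventually (gt_mem_nhds (by linarith : 0 < a + E₀))] with t ht h2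
    calc Real.log (f t) / t ≤ Real.log (C * Real.exp (-t * E₀)) / t := by
          gcongr
          · exact hf t ht
          · exact hub t ht
      _ = Real.log C / t - E₀ := hlog C hC E₀ t ht
      _ < a := by linarith

/-- A non-negative function `Φ` is determined by the products `Φ(x) Φ(y)`. -/
theorem eq_of_mul_self_eq {V : Type*} {Φ Ψ : V → ℝ} (hΦ : ∀ x, 0 ≤ Φ x) (hΨ : ∀ x, 0 ≤ Ψ x)
    (h : ∀ x, (Ψ x : ℂ) * Ψ x = (Φ x : ℂ) * Φ x) : Ψ = Φ :=
  funext fun x => (mul_self_inj (hΨ x) (hΦ x)).mp (by exact_mod_cast h x)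

section Rate

open UnboundedOp WeightedL2

variable {V : Type*} [MeasurableSpace V] [DiscreteMeasurableSpace V]
  {m : V → ℝ} {L : WeightedL2 m →ₗ.[ℂ] WeightedL2 m}

theorem UnboundedOp.bottom_nonneg {H : Type*} [NormedAddCommGroup H] [InnerProductSpace ℂ H]
    [CompleteSpace H] [Nontrivial H] {L : H →ₗ.[ℂ] H} (hsa : IsSelfAdjoint L)
    (hpos : IsNonnegative L) : 0 ≤ bottom L := by
  rw [bottom_eq hsa hpos, sub_nonneg, one_le_inv₀ (norm_resolvent_pos hsa hpos)]
  exact norm_resolvent_le_one hsa hpos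

theorem heatKernel_re_le (hm : ∀ x, 0 < m x) (hsa : IsSelfAdjoint L) (hpos : IsNonnegative L)
    {t : ℝ} (ht : 0 < t) (x y : V) :
    (heatKernel L t x y).re ≤
      ‖pointFunction m x‖ * ‖pointFunction m y‖ / (m x * m y) * Real.exp (-t * bottom L) := by
  have : Nonempty V := ⟨x⟩
  have : Nontrivial (WeightedL2 m) := WeightedL2.nontrivial hm
  have h1 := (Complex.re_le_norm _).trans (norm_inner_le_norm (𝕜 := ℂ) (pointFunction m x)
    (heatSemigroup L t (pointFunction m y)))
  rw [inner_pointFunction hm, heatSemigroup_pointFunction_apply hm, Complex.re_ofReal_mul,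
    Complex.re_mul_ofReal] at h1
  have h2 := mul_le_mul_of_nonneg_left (norm_heatSemigroup_apply_le hsa hpos ht
    (pointFunction m y)) (norm_nonneg (pointFunction m x))
  rw [div_mul_eq_mul_div, le_div_iff₀ (mul_pos (hm x) (hm y))]
  linarith

/-- `t ↦ p_t(x, x)` is decreasing, as `p_t(x, x)` is a multiple of `‖e^{-(t/2)L} δ_x‖²`. -/
theorem heatKernel_diag_antitone (hm : ∀ x, 0 < m x) (hsa : IsSelfAdjoint L)
    (hpos : IsNonnegative L) {s t : ℝ} (hs : 0 < s) (hst : s ≤ t) (x : V) :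
    (heatKernel L t x x).re ≤ (heatKernel L s x x).re := by
  have : Nonempty V := ⟨x⟩
  have : Nontrivial (WeightedL2 m) := WeightedL2.nontrivial hm
  rcases hst.eq_or_lt with rfl | hlt
  · exact le_rfl
  have h1 := heatKernel_diag_re (L := L) hm (half_pos hs) x
  have h2 := heatKernel_diag_re (L := L) hm (half_pos (hs.trans hlt)) x
  rw [add_halves] at h1 h2
  refine le_of_mul_le_mul_left (a := m x ^ 2) ?_ (pow_pos (hm x) 2)
  rw [h1, h2]
  have hd : 0 < (t - s) / 2 := by linarith
  have h3 : heatSemigroup L (t / 2) (pointFunction m x) =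
      heatSemigroup L ((t - s) / 2) (heatSemigroup L (s / 2) (pointFunction m x)) := by
    rw [← heatSemigroup_add_apply hd (half_pos hs)]
    congr 2
    ring
  have h4 : Real.exp (-((t - s) / 2) * bottom L) ≤ 1 := by
    rw [Real.exp_le_one_iff]
    have := mul_nonneg hd.le (bottom_nonneg hsa hpos)
    linarith
  rw [h3]
  gcongr
  exact (norm_heatSemigroup_apply_le hsa hpos hd _).trans
    (mul_le_of_le_one_left (norm_nonneg _) h4)

/-- The diagonal of the heat kernel cannot decay faster than `e^{-tE₀}` at any point: otherwise, by
strict positivity, it would do so at all points, and then so would the norm of the semigroup. -/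
theorem exists_heatKernel_diag_ge [Countable V] (hm : ∀ x, 0 < m x)
    {G : WeightedGraph V} (hG : G.IsConnected) (hsa : IsSelfAdjoint L) (hpos : IsNonnegative L)
    (hL : IsRestrictionOfFormalLaplacian G m L)
    (hpp : ∀ t : ℝ, 0 < t → IsPositivityPreserving (heatSemigroup L t)) {E : ℝ}
    (hE : bottom L < E) (x : V) :
    ∃ t : ℝ, 0 < t ∧ Real.exp (-t * E) ≤ (heatKernel L t x x).re * m x := by
  have : Nonempty V := ⟨x⟩
  have : Nontrivial (WeightedL2 m) := WeightedL2.nontrivial hm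
  by_contra! hcon
  have hpoint : ∀ y : V, ∃ C : ℝ, 0 ≤ C ∧ ∀ t : ℝ, 0 < t →
      ‖heatSemigroup L t (pointFunction m y)‖ ≤ C * Real.exp (-t * E) := by
    intro y
    set a := (heatKernel L 1 x y).re with ha
    set b := (heatKernel L 1 y x).re with hb
    have ha0 : 0 < a := (heatKernel_pos hm hG hsa hpos hL hpp one_pos x y).1
    have hb0 : 0 < b := (heatKernel_pos hm hG hsa hpos hL hpp one_pos y x).1
    have hx := hm x
    have hy := hm y
    set C := Real.exp (-2 * E) / (a * b * m x) with hC
    have hC0 : 0 < C := by positivity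
    refine ⟨√C, Real.sqrt_nonneg _, fun t ht => ?_⟩
    -- go from `x` to `y` in time 1, stay at `y` for time `2t`, and return in time 1
    have h1 := heatKernel_mul_le hm hpp (add_pos ht ht) one_pos y x y
    have h2 := heatKernel_mul_le hm hpp one_pos (add_pos (add_pos ht ht) one_pos) x x y
    have h3 := hcon (1 + (t + t + 1)) (by linarith)
    have h4 := heatKernel_diag_re (L := L) hm ht y
    have h5 : Real.exp (-(1 + (t + t + 1)) * E) = Real.exp (-2 * E) * Real.exp (-t * E) ^ 2 := by
      rw [← Real.exp_nat_mul, ← Real.exp_add]; congr 1; push_cast; ring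
    have h6 : a * b * m x * ‖heatSemigroup L t (pointFunction m y)‖ ^ 2 ≤
        Real.exp (-2 * E) * Real.exp (-t * E) ^ 2 := by
      rw [← h4, ← h5]
      refine le_trans ?_ h3.le
      have h7 := mul_le_mul_of_nonneg_right ((mul_le_mul_of_nonneg_right
        (mul_le_mul_of_nonneg_left h1 ha0.le) hy.le).trans h2) hx.le
      refine le_trans (le_of_eq ?_) h7
      ring
    refine abs_le_of_sq_le_sq' ?_ (by positivity) |>.2
    rw [mul_pow, Real.sq_sqrt hC0.le, hC, div_mul_eq_mul_div, le_div_iff₀ (by positivity)]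
    linarith
  have hspan : ∀ f ∈ (Submodule.span ℂ (Set.range (pointFunction m)) : Set (WeightedL2 m)),
      ∃ C : ℝ, ∀ t : ℝ, 0 < t → ‖heatSemigroup L t f‖ ≤ C * Real.exp (-t * E) := by
    intro f hf
    induction hf using Submodule.span_induction with
    | mem f hf =>
      obtain ⟨y, rfl⟩ := hf
      obtain ⟨C, -, hC⟩ := hpoint y
      exact ⟨C, hC⟩
    | zero => exact ⟨0, fun t _ => by simp⟩
    | add f g _ _ hf hg =>
      obtain ⟨C, hC⟩ := hf
      obtain ⟨D, hD⟩ := hg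
      refine ⟨C + D, fun t ht => ?_⟩
      rw [map_add, add_mul]
      exact (norm_add_le _ _).trans (add_le_add (hC t ht) (hD t ht))
    | smul c f _ hf =>
      obtain ⟨C, hC⟩ := hf
      refine ⟨‖c‖ * C, fun t ht => ?_⟩
      rw [map_smul, norm_smul, mul_assoc]
      exact mul_le_mul_of_nonneg_left (hC t ht) (norm_nonneg c)
  have h1 := norm_heatSemigroup_le_of_dense (dense_span_pointFunction hm) hspan one_pos
  rw [norm_heatSemigroup hsa hpos one_pos, Real.exp_le_exp] at h1
  linarith

/-- The supermultiplicativity of `t ↦ m(x) p_t(x, x)` propagates the bound at one time to all later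
times. -/
theorem exists_heatKernel_diag_lower_bound [Countable V] (hm : ∀ x, 0 < m x)
    {G : WeightedGraph V} (hG : G.IsConnected) (hsa : IsSelfAdjoint L) (hpos : IsNonnegative L)
    (hL : IsRestrictionOfFormalLaplacian G m L)
    (hpp : ∀ t : ℝ, 0 < t → IsPositivityPreserving (heatSemigroup L t)) {E : ℝ}
    (hE : bottom L < E) (x : V) :
    ∃ c s : ℝ, 0 < c ∧ 0 < s ∧ ∀ t : ℝ, 0 ≤ t →
      c * Real.exp (-t * E) ≤ (heatKernel L (t + s) x x).re := by
  have : Nonempty V := ⟨x⟩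
  have : Nontrivial (WeightedL2 m) := WeightedL2.nontrivial hm
  obtain ⟨s, hs, hse⟩ := exists_heatKernel_diag_ge hm hG hsa hpos hL hpp hE x
  have hE0 : 0 ≤ E := (bottom_nonneg hsa hpos).trans hE.le
  have hmul : ∀ (n : ℕ) (r : ℝ), 0 < r →
      Real.exp (-(n * s) * E) * (heatKernel L r x x).re ≤ (heatKernel L (n * s + r) x x).re := by
    intro n r hr
    induction n with
    | zero => simp
    | succ n ih =>
      have hr' : 0 < n * s + r := by positivity
      have h1 := heatKernel_mul_le hm hpp hs hr' x x x
      have h2 : Real.exp (-((n + 1 : ℕ) * s) * E) =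
          Real.exp (-s * E) * Real.exp (-(n * s) * E) := by
        rw [← Real.exp_add]; congr 1; push_cast; ring
      have h3 : ((n + 1 : ℕ) : ℝ) * s + r = s + (n * s + r) := by push_cast; ring
      rw [h2, h3, mul_assoc]
      refine le_trans (mul_le_mul_of_nonneg_left ih (Real.exp_pos _).le) (le_trans ?_ h1)
      rw [mul_right_comm]
      exact mul_le_mul_of_nonneg_right hse (heatKernel_nonneg hm hpp hr' x x).1
  have h2s : 0 < s + s := add_pos hs hs
  refine ⟨_, s, (heatKernel_pos hm hG hsa hpos hL hpp h2s x x).1, hs, fun t ht => ?_⟩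
  -- split `t + s = n s + r` with `s ≤ r ≤ 2 s`
  set n := ⌊t / s⌋₊ with hn
  have hn1 : n * s ≤ t := (le_div_iff₀ hs).mp (Nat.floor_le (by positivity))
  have hn2 : t < (n + 1) * s := (div_lt_iff₀ hs).mp (Nat.lt_floor_add_one _)
  set r := t + s - n * s with hr
  have hr0 : 0 < r := by linarith
  have hr2 : r ≤ s + s := by linarith
  have h1 := hmul n r hr0
  rw [show n * s + r = t + s by rw [hr]; ring] at h1
  refine le_trans ?_ h1
  rw [mul_comm]
  have h2 := heatKernel_diag_antitone hm hsa hpos hr0 hr2 x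
  have h3 := (heatKernel_nonneg hm hpp h2s x x).1
  have h4 := mul_le_mul_of_nonneg_right hn1 hE0
  gcongr ?_ * ?_
  rw [Real.exp_le_exp]
  linarith

theorem tendsto_log_heatKernel_div [Countable V] (hm : ∀ x, 0 < m x)
    {G : WeightedGraph V} (hG : G.IsConnected) (hsa : IsSelfAdjoint L) (hpos : IsNonnegative L)
    (hL : IsRestrictionOfFormalLaplacian G m L)
    (hpp : ∀ t : ℝ, 0 < t → IsPositivityPreserving (heatSemigroup L t)) (x y : V) :
    Tendsto (fun t : ℝ => Real.log (heatKernel L t x y).re / t) atTop (𝓝 (-bottom L)) := by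
  refine tendsto_log_div_of_exp_bounds
    (fun t ht => (heatKernel_pos hm hG hsa hpos hL hpp ht x y).1)
    (fun t ht => heatKernel_re_le hm hsa hpos ht x y) fun E hE => ?_
  obtain ⟨c, s, hc, hs, h⟩ := exists_heatKernel_diag_lower_bound hm hG hsa hpos hL hpp hE x
  have hp := (heatKernel_pos hm hG hsa hpos hL hpp one_pos x y).1
  refine ⟨c * Real.exp ((s + 1) * E) * (heatKernel L 1 x y).re * m x,
    mul_pos (mul_pos (mul_pos hc (Real.exp_pos _)) hp) (hm x), ?_⟩
  filter_upwards [eventually_ge_atTop (s + 1)] with t ht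
  have h1 := h (t - (s + 1)) (by linarith)
  have h2 := heatKernel_mul_le hm hpp (by linarith : 0 < t - (s + 1) + s) one_pos x y x
  rw [show t - (s + 1) + s + 1 = t by ring] at h2
  refine le_trans ?_ h2
  have h3 := mul_le_mul_of_nonneg_right (mul_le_mul_of_nonneg_right h1 hp.le) (hm x).le
  refine le_trans (le_of_eq ?_) h3
  rw [show -(t - (s + 1)) * E = (s + 1) * E + -t * E by ring, Real.exp_add]
  ring

/-! ### Eigenfunctions to the bottom of the spectrum -/

theorem isNormalizedEigenfunction_bottom_iff [Nonempty V] (hm : ∀ x, 0 < m x)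
    (hsa : IsSelfAdjoint L) (hpos : IsNonnegative L) (Ψ : V → ℝ) :
    IsNormalizedEigenfunction L (bottom L) Ψ ↔ ∃ ψ : WeightedL2 m,
      UnboundedOp.resolvent L (-1) ψ = (‖UnboundedOp.resolvent L (-1)‖ : ℂ) • ψ ∧ ‖ψ‖ = 1 ∧
      ∀ x, (ψ : V → ℂ) x = Ψ x := by
  have : Nontrivial (WeightedL2 m) := WeightedL2.nontrivial hm
  constructor
  · rintro ⟨u, h1, h2, h3⟩
    exact ⟨u, (eigen_bottom_iff hsa hpos _).mp ⟨u.2, h3⟩, h2, h1⟩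
  · rintro ⟨ψ, h1, h2, h3⟩
    obtain ⟨hd, h4⟩ := (eigen_bottom_iff hsa hpos _).mpr h1
    exact ⟨⟨ψ, hd⟩, h3, h2, h4⟩

theorem isEigenvalue_bottom_iff [Nonempty V] (hm : ∀ x, 0 < m x)
    (hsa : IsSelfAdjoint L) (hpos : IsNonnegative L) :
    IsEigenvalue L (bottom L) ↔ ∃ v : WeightedL2 m, v ≠ 0 ∧
      UnboundedOp.resolvent L (-1) v = (‖UnboundedOp.resolvent L (-1)‖ : ℂ) • v := by
  have : Nontrivial (WeightedL2 m) := WeightedL2.nontrivial hm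
  constructor
  · rintro ⟨u, h1, h2⟩
    exact ⟨u, h1, (eigen_bottom_iff hsa hpos _).mp ⟨u.2, h2⟩⟩
  · rintro ⟨v, h1, h2⟩
    obtain ⟨hd, h3⟩ := (eigen_bottom_iff hsa hpos _).mpr h2
    exact ⟨⟨v, hd⟩, h1, h3⟩

end Rate

theorem mainTheorem8 {V : Type*} [Countable V] [Nonempty V]
    [MeasurableSpace V] [DiscreteMeasurableSpace V]
    (m : V → ℝ) (hm : ∀ x, 0 < m x)
    (G : WeightedGraph V) (hG : G.IsConnected)
    (L : WeightedL2 m →ₗ.[ℂ] WeightedL2 m)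
    (hsa : IsSelfAdjoint L) (hpos : UnboundedOp.IsNonnegative L)
    (hL : IsRestrictionOfFormalLaplacian G m L)
    (hpp : ∀ t : ℝ, 0 < t → IsPositivityPreserving (UnboundedOp.heatSemigroup L t)) :
    -- the number `E₀` is the infimum of the spectrum of `L`
    IsGLB (UnboundedOp.realSpectrum L) (UnboundedOp.bottom L) ∧
    -- (a)
    (∃ Φ : V → ℝ,
      ((∀ x, 0 ≤ Φ x) ∧
        ∀ x y, Tendsto
          (fun t : ℝ => (Real.exp (t * UnboundedOp.bottom L) : ℂ) * heatKernel L t x y)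
          atTop (𝓝 ((Φ x : ℂ) * (Φ y : ℂ)))) ∧
      (∀ Ψ : V → ℝ, (∀ x, 0 ≤ Ψ x) →
        (∀ x y, Tendsto
          (fun t : ℝ => (Real.exp (t * UnboundedOp.bottom L) : ℂ) * heatKernel L t x y)
          atTop (𝓝 ((Ψ x : ℂ) * (Ψ y : ℂ)))) → Ψ = Φ) ∧
      (¬ UnboundedOp.IsEigenvalue L (UnboundedOp.bottom L) → Φ = 0) ∧
      (UnboundedOp.IsEigenvalue L (UnboundedOp.bottom L) →
        (∀ x, 0 < Φ x) ∧ IsNormalizedEigenfunction L (UnboundedOp.bottom L) Φ ∧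
        ∀ Ψ : V → ℝ, (∀ x, 0 ≤ Ψ x) →
          IsNormalizedEigenfunction L (UnboundedOp.bottom L) Ψ → Ψ = Φ)) ∧
    -- (b)
    (∀ x y, (∀ t : ℝ, 0 < t → 0 < (heatKernel L t x y).re ∧ (heatKernel L t x y).im = 0) ∧
      Tendsto (fun t : ℝ => Real.log (heatKernel L t x y).re / t) atTop
        (𝓝 (-UnboundedOp.bottom L))) := by
  have : Nontrivial (WeightedL2 m) := WeightedL2.nontrivial hm
  have hunique : ∀ Φ Ψ : V → ℝ, (∀ x, 0 ≤ Φ x) → (∀ x, 0 ≤ Ψ x) →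
      (∀ x y, Tendsto
        (fun t : ℝ => (Real.exp (t * UnboundedOp.bottom L) : ℂ) * heatKernel L t x y)
        atTop (𝓝 ((Φ x : ℂ) * (Φ y : ℂ)))) →
      (∀ x y, Tendsto
        (fun t : ℝ => (Real.exp (t * UnboundedOp.bottom L) : ℂ) * heatKernel L t x y)
        atTop (𝓝 ((Ψ x : ℂ) * (Ψ y : ℂ)))) → Ψ = Φ :=
    fun Φ Ψ hΦ hΨ h1 h2 =>
      eq_of_mul_self_eq hΦ hΨ fun x => tendsto_nhds_unique (h2 x x) (h1 x x)
  refine ⟨?_, ?_, fun x y => ⟨fun t ht => heatKernel_pos hm hG hsa hpos hL hpp ht x y,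
    tendsto_log_heatKernel_div hm hG hsa hpos hL hpp x y⟩⟩
  · rw [UnboundedOp.bottom_eq hsa hpos]
    exact (UnboundedOp.isLeast_realSpectrum hsa hpos).isGLB
  by_cases hev : UnboundedOp.IsEigenvalue L (UnboundedOp.bottom L)
  · obtain ⟨f, hf0, hf⟩ := (isEigenvalue_bottom_iff hm hsa hpos).mp hev
    obtain ⟨φ, Φ, hφ, hn, hΦ, hΦ0⟩ := exists_pos_eigenfunction hm hG hsa hpos hL hpp hf hf0
    -- every normalized eigenfunction yields the same limit of the rescaled kernel
    have hlim : ∀ (ψ : WeightedL2 m) (Ψ : V → ℝ), UnboundedOp.resolvent L (-1) ψ =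
        (‖UnboundedOp.resolvent L (-1)‖ : ℂ) • ψ → ‖ψ‖ = 1 → (∀ x, (ψ : V → ℂ) x = Ψ x) →
        ∀ x y, Tendsto
          (fun t : ℝ => (Real.exp (t * UnboundedOp.bottom L) : ℂ) * heatKernel L t x y)
          atTop (𝓝 ((Ψ x : ℂ) * (Ψ y : ℂ))) := fun ψ Ψ hψ hψn hΨ x y =>
      tendsto_heatKernel_ground_state hm hsa hpos hψ hψn hΨ (fun v hv =>
        exists_eq_smul_of_eigenfunction hm hG hsa hpos hL hpp hv hψ
          fun h => by simp [h] at hψn) x y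
    have hΦlim := hlim φ Φ hφ hn hΦ
    refine ⟨Φ, ⟨fun x => (hΦ0 x).le, hΦlim⟩,
      fun Ψ hΨ0 hΨ => hunique Φ Ψ (fun x => (hΦ0 x).le) hΨ0 hΦlim hΨ, fun h => absurd hev h,
      fun _ => ⟨hΦ0, (isNormalizedEigenfunction_bottom_iff hm hsa hpos Φ).mpr ⟨φ, hφ, hn, hΦ⟩,
        fun Ψ hΨ0 hΨ => ?_⟩⟩
    obtain ⟨ψ, hψ, hψn, hψΨ⟩ := (isNormalizedEigenfunction_bottom_iff hm hsa hpos Ψ).mp hΨ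
    exact hunique Φ Ψ (fun x => (hΦ0 x).le) hΨ0 hΦlim (hlim ψ Ψ hψ hψn hψΨ)
  · have hzero := tendsto_heatKernel_zero hm hsa hpos fun v hv => by
      by_contra hv0
      exact hev ((isEigenvalue_bottom_iff hm hsa hpos).mpr ⟨v, hv0, hv⟩)
    have hzero' : ∀ x y, Tendsto
        (fun t : ℝ => (Real.exp (t * UnboundedOp.bottom L) : ℂ) * heatKernel L t x y)
        atTop (𝓝 ((((0 : V → ℝ) x : ℝ) : ℂ) * (((0 : V → ℝ) y : ℝ) : ℂ))) := by
      simpa using hzero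
    exact ⟨0, ⟨fun _ => le_rfl, hzero'⟩,
      fun Ψ hΨ0 hΨ => hunique 0 Ψ (fun _ => le_rfl) hΨ0 hzero' hΨ, fun _ => rfl,
      fun h => absurd h hev⟩
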